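/- Let $\Delta=\mathbb R^8$ be the real spin representation in dimension $6$, i.e. the representation of the real Clifford algebra of $\mathbb R^6$ (with $v\cdot v=-|v|^2$) in which the standard basis $e_1,\dots,e_6$ acts by $$\begin{aligned}e_1&=E_{18}+E_{27}-E_{36}-E_{45},& e_2&=-E_{17}+E_{28}+E_{35}-E_{46},& e_3&=-E_{16}+E_{25}-E_{38}+E_{47},\\ e_4&=-E_{15}-E_{26}-E_{37}-E_{48},& e_5&=-E_{13}-E_{24}+E_{57}+E_{68},& e_6&=E_{14}-E_{23}-E_{58}+E_{67},\end{aligned}$$ where $E_{ij}\in\mathfrak{so}(8)$ maps the $i$-th basis vector of $\mathbb R^8$ to the $j$-th, the $j$-th to minus the $i$-th, and the others to $0$; let $(\cdot,\cdot)$ be the standard inner product of $\Delta$, and put $J=e_1\cdot e_2\cdot e_3\cdot e_4\cdot e_5\cdot e_6:\Delta\to\Delta$. To a unit spinor $\phi\in\Delta$ one associates the endomorphism $J_\phi$ and the $3$-form $\omega_\phi$ of $\mathbb R^6$ given by $$J_\phi(X)\cdot\phi=J(X\cdot\phi),\qquad \omega_\phi(X,Y,Z)=-(X\cdot Y\cdot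 Z\cdot\phi,\phi).$$ Identify $\mathbb R^6=\mathbb C^3$ by $z_k=x_{2k-1}+i\,x_{2k}$, and let $J_0$ be multiplication by $-i$ and $\omega_0=\mathrm{Re}(dz_1\wedge dz_2\wedge dz_3)$; the stabilizer of $(J_0,\omega_0)$ in $\mathrm{SO}(6)$ is the standard subgroup $\mathrm{SU}(3)$. (The sign of $J_0$ is the one for which the pairs $(J_\phi,\omega_\phi)$ belong to the $\mathrm{SO}(6)$-orbit of $(J_0,\omega_0)$.) An $\mathrm{SU}(3)$-structure on an oriented Riemannian $6$-manifold $(M,g)$ is a pair $(\mathcal J,\omega)$ of a smooth endomorphism field of $TM$ and a smooth $3$-form which at every point is given by $(J_0,\omega_0)$ in some positively oriented orthonormal frame. 1. (Pointwise.) There is a homeomorphism $\Phi:\mathrm{SO}(6)/\mathrm{SU}(3)\to\mathbb P(\Delta)=\mathbb{RP}^7$ such that, for every $A\in\mathrm{SO}(6)$ and every unit spinor $\phi\in\Delta$, one has $\Phi(A\,\mathrm{SU}(3))=[\phi]$ if and only if $A\cdot(J_0,\omega_0)=(J_\phi,\omega_\phi)$. 2. (Global.) Let $M$ be a simply connected,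 oriented, $6$-dimensional Riemannian manifold with a spin structure, and let $S$ be its real spinor bundle, associated with the spin structure by the representation $\Delta$ of $\mathrm{Spin}(6)$. For every smooth section $\phi$ of $S$ of length one, the pair $(J_\phi,\omega_\phi)$ defined at each point by the formulas above is an $\mathrm{SU}(3)$-structure on $M$; every $\mathrm{SU}(3)$-structure on $M$ is $(J_\phi,\omega_\phi)$ for some smooth section $\phi$ of $S$ of length one; and two such sections $\phi,\psi$ give the same $\mathrm{SU}(3)$-structure if and only if $\psi=\phi$ or $\psi=-\phi$. -/

import Mathlib

open scoped Manifold ContDiff Matrix LinearAlgebra.Projectivization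

noncomputable section

namespace SpinorSU3

/-! ### The real spin representation in dimension six -/

/-- The vector space `ℝ⁶` (its Euclidean inner product is the dot product). -/
abbrev Vec : Type := Fin 6 → ℝ

/-- The real spinor space `Δ = ℝ⁸`; its inner product is the dot product `φ ⬝ᵥ ψ`. -/
abbrev Spinor : Type := Fin 8 → ℝ

/-- The quadratic form `v ↦ -|v|²` on `ℝ⁶`: in its Clifford algebra `v · v = -|v|²`. -/
def negSq : QuadraticForm ℝ Vec :=
  QuadraticMap.weightedSumSquares ℝ (fun _ : Fin 6 => (-1 : ℝ))

/-- The endomorphism `E_{ij}` of `ℤ⁸` mapping `e_i` to `e_j`, `e_j` to `-e_i` and every other basis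
vector to `0` (the basis is indexed by `0, …, 7`). -/
def rotE (i j : Fin 8) : Matrix (Fin 8) (Fin 8) ℤ := fun p q =>
  if p = j ∧ q = i then 1 else if p = i ∧ q = j then -1 else 0

/-- The six Clifford matrices, with integer entries. -/
def gammaInt : Fin 6 → Matrix (Fin 8) (Fin 8) ℤ :=
  ![rotE 0 7 + rotE 1 6 - rotE 2 5 - rotE 3 4,
    -rotE 0 6 + rotE 1 7 + rotE 2 4 - rotE 3 5,
    -rotE 0 5 + rotE 1 4 - rotE 2 7 + rotE 3 6,
    -rotE 0 4 - rotE 1 5 - rotE 2 6 - rotE 3 7,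
    -rotE 0 2 - rotE 1 3 + rotE 4 6 + rotE 5 7,
    rotE 0 3 - rotE 1 2 - rotE 4 7 + rotE 5 6]

/-- The action of the basis vector `e_a` of `ℝ⁶` on `Δ`. -/
def gamma (a : Fin 6) : Matrix (Fin 8) (Fin 8) ℝ := (gammaInt a).map (Int.cast : ℤ → ℝ)

lemma gammaInt_anticomm : ∀ a b : Fin 6,
    gammaInt a * gammaInt b + gammaInt b * gammaInt a =
      if a = b then (-2 : ℤ) • (1 : Matrix (Fin 8) (Fin 8) ℤ) else 0 := by
  decide +kernel

lemma gamma_anticomm (a b : Fin 6) :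
    gamma a * gamma b + gamma b * gamma a =
      if a = b then (-2 : ℝ) • (1 : Matrix (Fin 8) (Fin 8) ℝ) else 0 := by
  have h := congrArg (Int.castRingHom ℝ).mapMatrix (gammaInt_anticomm a b)
  rw [map_add, map_mul, map_mul] at h
  have h' : gamma a * gamma b + gamma b * gamma a =
      (Int.castRingHom ℝ).mapMatrix
        (if a = b then (-2 : ℤ) • (1 : Matrix (Fin 8) (Fin 8) ℤ) else 0) := h
  rw [h']
  split_ifs
  · rw [map_zsmul, map_one, ← Int.cast_smul_eq_zsmul ℝ]
    norm_num
  · simp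

/-- Clifford multiplication by vectors of `ℝ⁶`, as a linear map to the endomorphisms of `Δ`. -/
def gammaLin : Vec →ₗ[ℝ] Matrix (Fin 8) (Fin 8) ℝ :=
  Fintype.linearCombination ℝ gamma

lemma gammaLin_sq (v : Vec) :
    gammaLin v * gammaLin v = algebraMap ℝ (Matrix (Fin 8) (Fin 8) ℝ) (negSq v) := by
  have hv : gammaLin v = ∑ a, v a • gamma a := by
    simp [gammaLin, Fintype.linearCombination_apply]
  have h1 : gammaLin v * gammaLin v = ∑ a, ∑ b, (v a * v b) • (gamma a * gamma b) := by
    rw [hv, Finset.sum_mul_sum]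
    refine Finset.sum_congr rfl fun a _ => Finset.sum_congr rfl fun b _ => ?_
    rw [smul_mul_smul_comm]
  have h2 : gammaLin v * gammaLin v = ∑ a, ∑ b, (v a * v b) • (gamma b * gamma a) := by
    rw [h1, Finset.sum_comm]
    refine Finset.sum_congr rfl fun a _ => Finset.sum_congr rfl fun b _ => ?_
    rw [mul_comm]
  have h3 : (2 : ℝ) • (gammaLin v * gammaLin v) =
      (2 : ℝ) • algebraMap ℝ (Matrix (Fin 8) (Fin 8) ℝ) (negSq v) := by
    rw [two_smul]
    nth_rewrite 1 [h1]
    rw [h2, ← Finset.sum_add_distrib]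
    simp_rw [← Finset.sum_add_distrib, ← smul_add, gamma_anticomm]
    simp only [smul_ite, smul_zero, Finset.sum_ite_eq, Finset.mem_univ, if_true]
    simp_rw [smul_smul]
    rw [← Finset.sum_smul, Algebra.algebraMap_eq_smul_one, smul_smul]
    congr 1
    simp only [negSq, QuadraticMap.weightedSumSquares_apply, smul_eq_mul, Finset.mul_sum]
    refine Finset.sum_congr rfl fun a _ => ?_
    ring
  exact smul_right_injective _ (two_ne_zero : (2 : ℝ) ≠ 0) h3

/-- The representation of the real Clifford algebra of `ℝ⁶` on `Δ`. -/
def rep : CliffordAlgebra negSq →ₐ[ℝ] Matrix (Fin 8) (Fin 8) ℝ :=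
  CliffordAlgebra.lift negSq ⟨gammaLin, gammaLin_sq⟩

/-- The action on spinors of a vector of `ℝ⁶`. -/
def cl (v : Vec) : Matrix (Fin 8) (Fin 8) ℝ := rep (CliffordAlgebra.ι negSq v)

/-- The `Spin(6)`-invariant complex structure `J = e₁·e₂·e₃·e₄·e₅·e₆` of `Δ`. -/
def volJ : Matrix (Fin 8) (Fin 8) ℝ :=
  gamma 0 * gamma 1 * gamma 2 * gamma 3 * gamma 4 * gamma 5

/-- The group `Spin(6)`. -/
abbrev Spin6 : Type := spinGroup negSq

/-- `s ∈ Spin(6)` lies over the matrix `A` for the covering `Spin(6) → SO(6)`,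
that is `s · v · s⁻¹ = A v` for all `v ∈ ℝ⁶`. -/
def LiesOver (s : Spin6) (A : Matrix (Fin 6) (Fin 6) ℝ) : Prop :=
  ∀ v : Vec, (s : CliffordAlgebra negSq) * CliffordAlgebra.ι negSq v *
    ((s⁻¹ : Spin6) : CliffordAlgebra negSq) = CliffordAlgebra.ι negSq (A *ᵥ v)

/-- The formulas `J_φ(X) · φ = J (X · φ)` and `ω_φ(X, Y, Z) = -(X · Y · Z · φ, φ)` for the pair
determined by a spinor `φ`; `c` is the Clifford multiplication by vectors. -/
def IsInducedPair {V : Type*} (c : V → Matrix (Fin 8) (Fin 8) ℝ) (φ : Spinor)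
    (J : V → V) (Om : V → V → V → ℝ) : Prop :=
  (∀ X, c (J X) *ᵥ φ = volJ *ᵥ (c X *ᵥ φ)) ∧
    ∀ X Y Z, Om X Y Z = -(((c X * c Y * c Z) *ᵥ φ) ⬝ᵥ φ)

/-! ### The standard `SU(3)`-structure of `ℝ⁶` -/

/-- The identification `ℝ⁶ = ℂ³`, `z_k = x_{2k-1} + i x_{2k}`. -/
def toC3 (x : Vec) : Fin 3 → ℂ := ![⟨x 0, x 1⟩, ⟨x 2, x 3⟩, ⟨x 4, x 5⟩]

lemma toC3_injective : Function.Injective toC3 := by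
  intro x y h
  have h0 := congrFun h 0
  have h1 := congrFun h 1
  have h2 := congrFun h 2
  simp only [toC3, Matrix.cons_val, Complex.mk.injEq] at h0 h1 h2
  funext a
  fin_cases a
  exacts [h0.1, h0.2, h1.1, h1.2, h2.1, h2.2]

/-- The complex structure of the standard `SU(3)`-structure of `ℝ⁶ = ℂ³`: multiplication by `-i`.
(With `J = e₁⋯e₆`, the structures `J_φ` induce the orientation opposite to that of
`e₁, …, e₆`, whence the sign. The stabilizer in `SO(6)` of the pair `(stdJ, stdOmega)` is
the standard subgroup `SU(3)`.) -/
def stdJ (x : Vec) : Vec := ![x 1, -x 0, x 3, -x 2, x 5, -x 4]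

lemma toC3_stdJ (x : Vec) : toC3 (stdJ x) = (-Complex.I) • toC3 x := by
  funext k
  fin_cases k <;> apply Complex.ext <;> simp [toC3, stdJ]

/-- The real `3`-form `Re (dz₁ ∧ dz₂ ∧ dz₃)`. -/
def stdOmega (x : Fin 3 → Vec) : ℝ :=
  (Matrix.det (Matrix.of fun l k : Fin 3 => toC3 (x l) k)).re

/-- The group `SO(6)`. -/
abbrev SO6 : Type := Matrix.specialOrthogonalGroup (Fin 6) ℝ

/-- The standard subgroup `SU(3)` of `SO(6)`, acting on `ℝ⁶ = ℂ³`. -/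
def SU3 : Subgroup SO6 where
  carrier := {A | ∃ U ∈ Matrix.specialUnitaryGroup (Fin 3) ℂ,
    ∀ x : Vec, toC3 (A.1 *ᵥ x) = U *ᵥ toC3 x}
  one_mem' := ⟨1, one_mem _, fun x => by simp⟩
  mul_mem' := by
    rintro A B ⟨U, hU, hA⟩ ⟨W, hW, hB⟩
    refine ⟨U * W, mul_mem hU hW, fun x => ?_⟩
    have : (A * B).1 = A.1 * B.1 := rfl
    rw [this, ← Matrix.mulVec_mulVec, hA, hB, Matrix.mulVec_mulVec]
  inv_mem' := by
    rintro A ⟨U, hU, hA⟩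
    refine ⟨star U, (star (⟨U, hU⟩ : Matrix.specialUnitaryGroup (Fin 3) ℂ)).2, fun x => ?_⟩
    have h1 : A.1 * (A⁻¹).1 = 1 := congrArg Subtype.val (mul_inv_cancel A)
    have h2 : star U * U = 1 := (Matrix.mem_specialUnitaryGroup_iff.1 hU).1.1
    have h3 : toC3 x = U *ᵥ toC3 ((A⁻¹).1 *ᵥ x) := by
      rw [← hA, Matrix.mulVec_mulVec, h1, Matrix.one_mulVec]
    rw [h3, Matrix.mulVec_mulVec, h2, Matrix.one_mulVec]

/-- The complex structure of the `SU(3)`-structure `A · (stdJ, stdOmega)` of `ℝ⁶`. -/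
def rotJ (A : SO6) (X : Vec) : Vec := A.1 *ᵥ stdJ ((A⁻¹).1 *ᵥ X)

/-- The `3`-form of the `SU(3)`-structure `A · (stdJ, stdOmega)` of `ℝ⁶`. -/
def rotOmega (A : SO6) (X Y Z : Vec) : ℝ :=
  stdOmega ![(A⁻¹).1 *ᵥ X, (A⁻¹).1 *ᵥ Y, (A⁻¹).1 *ᵥ Z]

/-- The quotient topology of the real projective space `ℙ(Δ) = ℝℙ⁷`. -/
instance : TopologicalSpace (ℙ ℝ Spinor) :=
  inferInstanceAs (TopologicalSpace (Quotient (projectivizationSetoid ℝ Spinor)))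

lemma Spinor.ne_zero {φ : Spinor} (h : φ ⬝ᵥ φ = 1) : φ ≠ 0 := by
  rintro rfl
  simp at h

/-! ### Oriented Riemannian manifolds -/

section Manifold

/-- The model space of six-dimensional manifolds. -/
abbrev E6 : Type := EuclideanSpace ℝ (Fin 6)

variable (M : Type*) [TopologicalSpace M] [ChartedSpace E6 M] [IsManifold (𝓡 6) ∞ M]

/-- A smooth Riemannian metric on `M`. -/
abbrev Metric : Type _ :=
  Bundle.ContMDiffRiemannianMetric (𝓡 6) ∞ E6 (fun x : M => TangentSpace (𝓡 6) x)

variable {M}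

/-- The vector field `X` is smooth on `U`. -/
def SmoothFieldOn (X : ∀ x : M, TangentSpace (𝓡 6) x) (U : Set M) : Prop :=
  ContMDiffOn (𝓡 6) (𝓡 6).tangent ∞ (fun x => (⟨x, X x⟩ : TangentBundle (𝓡 6) M)) U

/-- The six vectors `f` form a basis with orientation `o`. -/
def IsPositive {V : Type*} [AddCommGroup V] [Module ℝ V] (o : Orientation ℝ V (Fin 6))
    (f : Fin 6 → V) : Prop :=
  ∃ b : Module.Basis (Fin 6) ℝ V, ⇑b = f ∧ b.orientation = o

variable (M) in
/-- An orientation of `M`: an orientation of every tangent space, such that near every point there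
is a smooth positively oriented frame. -/
structure ManifoldOrientation where
  /-- The orientation of the tangent space at `x`. -/
  at_ (x : M) : Orientation ℝ (TangentSpace (𝓡 6) x) (Fin 6)
  exists_frame (x : M) : ∃ U : Set M, IsOpen U ∧ x ∈ U ∧
    ∃ f : Fin 6 → ∀ y : M, TangentSpace (𝓡 6) y,
      (∀ a, SmoothFieldOn (f a) U) ∧ ∀ y ∈ U, IsPositive (at_ y) (fun a => f a y)

variable (g : Metric M) (o : ManifoldOrientation M)

/-- `f` is a positively oriented orthonormal frame of the tangent space at `x`. -/
def IsOrientedOrthonormal (x : M) (f : Fin 6 → TangentSpace (𝓡 6) x) : Prop :=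
  (∀ a b, g.inner x (f a) (f b) = if a = b then 1 else 0) ∧ IsPositive (o.at_ x) f

/-! ### `SU(3)`-structures -/

/-- An `SU(3)`-structure on the oriented Riemannian manifold `M`: an almost complex structure `J`
and a `3`-form `Om`, both smooth, which at every point correspond to the standard pair
`(stdJ, stdOmega)` of `ℝ⁶` under some positively oriented orthonormal frame. -/
structure SU3Structure where
  /-- The almost complex structure. -/
  J (x : M) : TangentSpace (𝓡 6) x →ₗ[ℝ] TangentSpace (𝓡 6) x
  /-- The real `3`-form. -/
  Om (x : M) : (TangentSpace (𝓡 6) x) [⋀^Fin 3]→ₗ[ℝ] ℝ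
  adapted (x : M) : ∃ f : Fin 6 → TangentSpace (𝓡 6) x, IsOrientedOrthonormal g o x f ∧
    (∀ v : Vec, J x (∑ a, v a • f a) = ∑ a, stdJ v a • f a) ∧
    ∀ v : Fin 3 → Vec, Om x (fun l => ∑ a, v l a • f a) = stdOmega v
  smooth_J : ∀ (U : Set M) (X : ∀ x : M, TangentSpace (𝓡 6) x), IsOpen U →
    SmoothFieldOn X U → SmoothFieldOn (fun x => J x (X x)) U
  smooth_Om : ∀ (U : Set M) (X : Fin 3 → ∀ x : M, TangentSpace (𝓡 6) x), IsOpen U →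
    (∀ l, SmoothFieldOn (X l) U) →
      ContMDiffOn (𝓡 6) 𝓘(ℝ, ℝ) ∞ (fun x => Om x (fun l => X l x)) U

/-! ### Spin structures and spinor fields -/

/-- A spin structure on the oriented Riemannian manifold `M`, given by local data: an open cover
`U_i`, smooth positively oriented orthonormal frames over the `U_i`, and smooth lifts to `Spin(6)`
of the transition functions `U_i ∩ U_j → SO(6)` of the frame bundle satisfying the cocycle
condition. Here `lift i j` passes from coordinates in the frame `i` to coordinates in the
frame `j`. -/
structure SpinStructure (ι : Type*) where
  /-- The members `U_i` of the open cover. -/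
  baseSet : ι → Set M
  isOpen_baseSet : ∀ i, IsOpen (baseSet i)
  /-- A member of the cover containing `x`. -/
  indexAt : M → ι
  mem_baseSet_at : ∀ x, x ∈ baseSet (indexAt x)
  /-- The orthonormal frame over `U_i`. -/
  frame : ι → Fin 6 → ∀ x : M, TangentSpace (𝓡 6) x
  smooth_frame : ∀ i a, SmoothFieldOn (frame i a) (baseSet i)
  frame_orthonormal : ∀ i, ∀ x ∈ baseSet i, IsOrientedOrthonormal g o x (fun a => frame i a x)
  /-- The lifts to `Spin(6)` of the transition functions. -/
  lift : ι → ι → M → Spin6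
  smooth_lift : ∀ i j p q, ContMDiffOn (𝓡 6) 𝓘(ℝ, ℝ) ∞
    (fun x => rep (lift i j x) p q) (baseSet i ∩ baseSet j)
  lift_liesOver : ∀ i j, ∀ x ∈ baseSet i ∩ baseSet j,
    LiesOver (lift i j x) (Matrix.of fun a b => g.inner x (frame j a x) (frame i b x))
  lift_comp : ∀ i j k, ∀ x ∈ baseSet i ∩ baseSet j ∩ baseSet k,
    lift j k x * lift i j x = lift i k x

variable {g o} {ι : Type*}

/-- The action of a matrix on spinors, as a continuous linear map depending linearly on it. -/
def matCLM : Matrix (Fin 8) (Fin 8) ℝ →ₗ[ℝ] (Spinor →L[ℝ] Spinor) :=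
  (LinearMap.toContinuousLinearMap (𝕜 := ℝ) (E := Spinor) (F' := Spinor)).toLinearMap ∘ₗ
    (Matrix.toLin' (R := ℝ) (m := Fin 8) (n := Fin 8)).toLinearMap

lemma matCLM_apply (A : Matrix (Fin 8) (Fin 8) ℝ) (v : Spinor) : matCLM A v = A *ᵥ v := rfl

lemma matCLM_eq_sum (A : Matrix (Fin 8) (Fin 8) ℝ) :
    matCLM A = ∑ p, ∑ q, A p q • matCLM (Matrix.single p q 1) := by
  conv_lhs => rw [Matrix.matrix_eq_sum_single A]
  simp only [map_sum]
  refine Finset.sum_congr rfl fun p _ => Finset.sum_congr rfl fun q _ => ?_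
  rw [← map_smul, Matrix.smul_single, smul_eq_mul, mul_one]

namespace SpinStructure

variable (σ : SpinStructure g o ι)

lemma contMDiffOn_lift (i j : ι) : ContMDiffOn (𝓡 6) 𝓘(ℝ, Spinor →L[ℝ] Spinor) ∞
    (fun x => matCLM (rep (σ.lift i j x))) (σ.baseSet i ∩ σ.baseSet j) := by
  simp_rw [fun x => matCLM_eq_sum (rep (σ.lift i j x))]
  refine contMDiffOn_finsetSum fun p _ => contMDiffOn_finsetSum fun q _ => ?_
  exact (σ.smooth_lift i j p q).smul contMDiffOn_const

lemma lift_self (i : ι) (x : M) (hx : x ∈ σ.baseSet i) : σ.lift i i x = 1 :=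
  mul_eq_left.1 (σ.lift_comp i i i x ⟨⟨hx, hx⟩, hx⟩)

/-- The real spinor bundle, associated with the spin structure by the representation of `Spin(6)`
on `Δ`. -/
def spinorBundle : VectorBundleCore ℝ M Spinor ι where
  baseSet := σ.baseSet
  isOpen_baseSet := σ.isOpen_baseSet
  indexAt := σ.indexAt
  mem_baseSet_at := σ.mem_baseSet_at
  coordChange i j x := matCLM (rep (σ.lift i j x))
  coordChange_self i x hx v := by
    rw [σ.lift_self i x hx, matCLM_apply]
    simp
  continuousOn_coordChange i j := (σ.contMDiffOn_lift i j).continuousOn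
  coordChange_comp i j k x hx v := by
    rw [← σ.lift_comp i j k x hx]
    simp only [matCLM_apply, Matrix.mulVec_mulVec]
    rw [← map_mul]
    rfl

instance : σ.spinorBundle.IsContMDiff (𝓡 6) ∞ where
  contMDiffOn_coordChange := σ.contMDiffOn_lift

/-- A smooth real spinor field: a smooth section of the real spinor bundle. -/
abbrev SpinorField : Type _ := ContMDiffSection (𝓡 6) Spinor ∞ σ.spinorBundle.Fiber

variable {σ}

/-- The function on `U_i` with values in `Δ` representing a spinor field over the frame `i`. -/
def coord (φ : σ.SpinorField) (i : ι) (x : M) : Spinor :=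
  σ.spinorBundle.coordChange (σ.indexAt x) i x (φ x)

/-- The spinor field `φ` has length one at every point. -/
def IsUnit (φ : σ.SpinorField) : Prop :=
  ∀ i, ∀ x ∈ σ.baseSet i, coord φ i x ⬝ᵥ coord φ i x = 1

variable (σ) in
/-- Clifford multiplication by a tangent vector, over the frame `i`. -/
def clAt (i : ι) (x : M) (X : TangentSpace (𝓡 6) x) : Matrix (Fin 8) (Fin 8) ℝ :=
  cl fun a => g.inner x (σ.frame i a x) X

/-- The `SU(3)`-structure `S` is the pair `(J_φ, ω_φ)` determined by the spinor field `φ`. -/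
def Induces (φ : σ.SpinorField) (S : SU3Structure g o) : Prop :=
  ∀ i, ∀ x ∈ σ.baseSet i,
    IsInducedPair (σ.clAt i x) (coord φ i x) (S.J x) (fun X Y Z => S.Om x ![X, Y, Z])

end SpinStructure

end Manifold

end SpinorSU3

end

/-!
# `SU(3)`-structures and real spinors in dimension six

For a unit spinor `φ` the eight spinors `φ`, `J φ`, `e_a · φ` form an orthonormal basis of `Δ`.
Hence unit vectors can be chosen so that any other unit spinor is `v · w · φ`
(`exists_cl_mul_cl_mulVec_eq`), and `v · w` lifts a rotation. Conversely every rotation lifts to an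
orthogonal transformation of `Δ` commuting with `J`: by the theorem of Cartan and Dieudonné it is a
product of reflections, and the reflection along `v` is lifted by `J · v`
(`SO6.exists_spinorLift`). As the first basis spinor induces the standard pair
(`isInducedPair_std`), equivariance shows that the pairs induced by unit spinors are exactly the
pairs `A · (J₀, ω₀)` with `A ∈ SO(6)`.

A unit spinor is determined up to sign by its `3`-form: the form acts on `Δ`, up to normalisation,
by `D = φ φᵀ - (J φ)(J φ)ᵀ`, so that `φ φᵀ = (D + D²) / 2` is a polynomial in the form
(`spinorProj_eq`). This identity is checked on the base spinor and transported by equivariance.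
Together with the computation of the stabilizer of `(J₀, ω₀)` (`mem_SU3_iff`) it yields a bijection
from `SO(6)/SU(3)` to `ℝℙ⁷`. It is continuous, because `[φ] ↦ φ φᵀ` embeds `ℝℙ⁷` into the matrices
and `φ φᵀ` depends polynomially on the form; hence it is a homeomorphism,
because the source is compact and the target Hausdorff (`exists_homeomorph`).

On the manifold, everything is done in the frames of the spin structure; elements of `Spin(6)` act
orthogonally and commute with `J`, so inducing a pair does not depend on the frame
(`isInducedPair_repr`). The pair of a smooth unit spinor field is smooth, since its components are
quadratic in the spinor (`exists_induces`). Conversely, given an `SU(3)`-structure, applying the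
smooth projection `φ φᵀ` to a constant spinor and normalising gives smooth inducing spinor fields
locally (`exists_local_inducing`). They are unique up to sign, and the signs form a cocycle, that is,
a double covering of `M`; as `M` is simply connected, this covering has a section
(`exists_sign_section`), which patches the local fields together (`exists_spinorField_induces`). Two
global fields inducing the same structure differ by a continuous sign, which is constant because
`M` is connected (`eq_or_eq_neg_of_induces`).
-/

namespace SpinorSU3

/-! ### Clifford multiplication on spinors -/

lemma cl_eq_sum (v : Vec) : cl v = ∑ a, v a • gamma a := by
  simp [cl, rep, gammaLin, Fintype.linearCombination_apply]

lemma cl_eq_gammaLin (v : Vec) : cl v = gammaLin v := by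
  simp [cl, rep]

lemma cl_add (v w : Vec) : cl (v + w) = cl v + cl w := by simp [cl_eq_gammaLin]

lemma cl_smul (r : ℝ) (v : Vec) : cl (r • v) = r • cl v := by simp [cl_eq_gammaLin]

lemma cl_neg (v : Vec) : cl (-v) = -cl v := by simp [cl_eq_gammaLin]

lemma cl_single (a : Fin 6) : cl (Pi.single a 1) = gamma a := by
  simp [cl_eq_sum, Pi.single_apply]

lemma cl_mul_self (v : Vec) : cl v * cl v = -(v ⬝ᵥ v) • (1 : Matrix (Fin 8) (Fin 8) ℝ) := by
  rw [cl_eq_gammaLin, gammaLin_sq, Algebra.algebraMap_eq_smul_one]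
  simp [negSq, QuadraticMap.weightedSumSquares_apply, dotProduct]

lemma cl_mul_add_mul (v w : Vec) :
    cl v * cl w + cl w * cl v = (-2 * (v ⬝ᵥ w)) • (1 : Matrix (Fin 8) (Fin 8) ℝ) := by
  have h := cl_mul_self (v + w)
  rw [cl_add, add_mul, mul_add, mul_add, cl_mul_self, cl_mul_self] at h
  have e : (v + w) ⬝ᵥ (v + w) = v ⬝ᵥ v + 2 * (v ⬝ᵥ w) + w ⬝ᵥ w := by
    rw [add_dotProduct, dotProduct_add, dotProduct_add, dotProduct_comm w v]; ring
  rw [e] at h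
  have h2 : cl v * cl w + cl w * cl v = -(v ⬝ᵥ v + 2 * (v ⬝ᵥ w) + w ⬝ᵥ w) •
      (1 : Matrix (Fin 8) (Fin 8) ℝ) - (-(v ⬝ᵥ v)) • (1 : Matrix (Fin 8) (Fin 8) ℝ)
      - (-(w ⬝ᵥ w)) • (1 : Matrix (Fin 8) (Fin 8) ℝ) := by
    rw [← h]; abel
  rw [h2, ← sub_smul, ← sub_smul]
  congr 1; ring

/-- The explicit integer matrix of `J = e₁·e₂·e₃·e₄·e₅·e₆`. -/
def volJInt : Matrix (Fin 8) (Fin 8) ℤ := rotE 1 0 + rotE 2 3 + rotE 4 5 + rotE 7 6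

lemma volJ_eq_map : volJ = (Int.castRingHom ℝ).mapMatrix volJInt := by
  have h : volJInt = gammaInt 0 * gammaInt 1 * gammaInt 2 * gammaInt 3 * gammaInt 4 * gammaInt 5 := by
    decide +kernel
  rw [h]
  rw [map_mul, map_mul, map_mul, map_mul, map_mul]
  rfl

lemma gamma_transpose (a : Fin 6) : (gamma a)ᵀ = -gamma a := by
  have h : ∀ a, (gammaInt a)ᵀ = -gammaInt a := by decide +kernel
  ext p q
  have := congrFun (congrFun (h a) p) q
  simp only [Matrix.transpose_apply, Matrix.neg_apply] at this
  simp [gamma, this]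

lemma cl_transpose (v : Vec) : (cl v)ᵀ = -cl v := by
  simp [cl_eq_sum, Matrix.transpose_sum, gamma_transpose]

lemma volJ_transpose : volJᵀ = -volJ := by
  have h : volJIntᵀ = -volJInt := by decide +kernel
  ext p q
  have := congrFun (congrFun h p) q
  simp only [Matrix.transpose_apply, Matrix.neg_apply] at this
  simp [volJ_eq_map, this]

lemma volJ_mul_self : volJ * volJ = -1 := by
  have h : volJInt * volJInt = -1 := by decide +kernel
  rw [volJ_eq_map, ← map_mul, h, map_neg, map_one]

lemma volJ_mul_gamma (a : Fin 6) : volJ * gamma a = -(gamma a * volJ) := by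
  have h : ∀ a, volJInt * gammaInt a = -(gammaInt a * volJInt) := by decide +kernel
  have e : gamma a = (Int.castRingHom ℝ).mapMatrix (gammaInt a) := rfl
  rw [volJ_eq_map, e, ← map_mul, ← map_mul, h, map_neg]

lemma volJ_mul_cl (v : Vec) : volJ * cl v = -(cl v * volJ) := by
  simp [cl_eq_sum, Finset.mul_sum, Finset.sum_mul, volJ_mul_gamma]

lemma cl_mul_volJ (v : Vec) : cl v * volJ = -(volJ * cl v) := by
  rw [volJ_mul_cl, neg_neg]

lemma mulVec_dotProduct_eq {n : Type*} [Fintype n] (A : Matrix n n ℝ) (x y : n → ℝ) :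
    (A *ᵥ x) ⬝ᵥ y = x ⬝ᵥ (Aᵀ *ᵥ y) := by
  rw [Matrix.dotProduct_mulVec, Matrix.vecMul_transpose]

lemma cl_mulVec_dotProduct (v : Vec) (φ ψ : Spinor) :
    (cl v *ᵥ φ) ⬝ᵥ ψ = -(φ ⬝ᵥ (cl v *ᵥ ψ)) := by
  rw [mulVec_dotProduct_eq, cl_transpose, Matrix.neg_mulVec, dotProduct_neg]

lemma volJ_mulVec_dotProduct (φ ψ : Spinor) :
    (volJ *ᵥ φ) ⬝ᵥ ψ = -(φ ⬝ᵥ (volJ *ᵥ ψ)) := by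
  rw [mulVec_dotProduct_eq, volJ_transpose, Matrix.neg_mulVec, dotProduct_neg]

lemma volJ_mulVec_dotProduct_volJ (φ ψ : Spinor) :
    (volJ *ᵥ φ) ⬝ᵥ (volJ *ᵥ ψ) = φ ⬝ᵥ ψ := by
  rw [volJ_mulVec_dotProduct, Matrix.mulVec_mulVec, volJ_mul_self, Matrix.neg_mulVec,
    Matrix.one_mulVec, dotProduct_neg, neg_neg]

lemma cl_mulVec_dotProduct_self (v : Vec) (φ : Spinor) : (cl v *ᵥ φ) ⬝ᵥ φ = 0 := by
  have := cl_mulVec_dotProduct v φ φ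
  rw [dotProduct_comm φ] at this
  linarith

lemma volJ_mulVec_dotProduct_self (φ : Spinor) : (volJ *ᵥ φ) ⬝ᵥ φ = 0 := by
  have := volJ_mulVec_dotProduct φ φ
  rw [dotProduct_comm φ] at this
  linarith

lemma cl_mulVec_dotProduct_volJ (v : Vec) (φ : Spinor) : (cl v *ᵥ φ) ⬝ᵥ (volJ *ᵥ φ) = 0 := by
  -- the matrix `J · v` is skew, because `J` and `v` are skew and anticommute
  have h1 : (cl v *ᵥ φ) ⬝ᵥ (volJ *ᵥ φ) = -(φ ⬝ᵥ ((cl v * volJ) *ᵥ φ)) := by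
    rw [cl_mulVec_dotProduct, Matrix.mulVec_mulVec]
  have h2 : (volJ *ᵥ φ) ⬝ᵥ (cl v *ᵥ φ) = -(φ ⬝ᵥ ((volJ * cl v) *ᵥ φ)) := by
    rw [volJ_mulVec_dotProduct, Matrix.mulVec_mulVec]
  rw [volJ_mul_cl, Matrix.neg_mulVec, dotProduct_neg, dotProduct_comm] at h2
  linarith

lemma cl_mulVec_dotProduct_cl (v w : Vec) (φ : Spinor) :
    (cl v *ᵥ φ) ⬝ᵥ (cl w *ᵥ φ) = (v ⬝ᵥ w) * (φ ⬝ᵥ φ) := by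
  have h1 : (cl v *ᵥ φ) ⬝ᵥ (cl w *ᵥ φ) = -(φ ⬝ᵥ ((cl v * cl w) *ᵥ φ)) := by
    rw [cl_mulVec_dotProduct, Matrix.mulVec_mulVec]
  have h2 : (cl w *ᵥ φ) ⬝ᵥ (cl v *ᵥ φ) = -(φ ⬝ᵥ ((cl w * cl v) *ᵥ φ)) := by
    rw [cl_mulVec_dotProduct, Matrix.mulVec_mulVec]
  have h3 : φ ⬝ᵥ ((cl v * cl w + cl w * cl v) *ᵥ φ) = (-2 * (v ⬝ᵥ w)) * (φ ⬝ᵥ φ) := by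
    rw [cl_mul_add_mul, Matrix.smul_mulVec, Matrix.one_mulVec, dotProduct_smul, smul_eq_mul]
  rw [Matrix.add_mulVec, dotProduct_add] at h3
  rw [dotProduct_comm (cl w *ᵥ φ)] at h2
  linarith

lemma cl_mulVec_injective {φ : Spinor} (hφ : φ ⬝ᵥ φ = 1) {v w : Vec}
    (h : cl v *ᵥ φ = cl w *ᵥ φ) : v = w := by
  have h0 : cl (v - w) *ᵥ φ = 0 := by
    rw [sub_eq_add_neg, cl_add, cl_neg, Matrix.add_mulVec, Matrix.neg_mulVec, h, add_neg_cancel]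
  have h1 := cl_mulVec_dotProduct_cl (v - w) (v - w) φ
  rw [h0, hφ, mul_one, zero_dotProduct] at h1
  exact sub_eq_zero.1 (dotProduct_self_eq_zero.1 h1.symm)

/-- The spinors `φ`, `J φ` and `e_a · φ`. -/
def adaptedBasis (φ : Spinor) : (Fin 1 ⊕ Fin 1) ⊕ Fin 6 → Spinor :=
  Sum.elim (Sum.elim (fun _ => φ) fun _ => volJ *ᵥ φ) fun a => gamma a *ᵥ φ

lemma adaptedBasis_orthonormal {φ : Spinor} (hφ : φ ⬝ᵥ φ = 1) (i j : (Fin 1 ⊕ Fin 1) ⊕ Fin 6) :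
    adaptedBasis φ i ⬝ᵥ adaptedBasis φ j = if i = j then 1 else 0 := by
  have h1 : ∀ a, (gamma a *ᵥ φ) ⬝ᵥ φ = 0 := fun a => by
    rw [← cl_single, cl_mulVec_dotProduct_self]
  have h2 : ∀ a, (gamma a *ᵥ φ) ⬝ᵥ (volJ *ᵥ φ) = 0 := fun a => by
    rw [← cl_single, cl_mulVec_dotProduct_volJ]
  have h3 : ∀ a b, (gamma a *ᵥ φ) ⬝ᵥ (gamma b *ᵥ φ) = if a = b then 1 else 0 := fun a b => by
    rw [← cl_single, ← cl_single, cl_mulVec_dotProduct_cl, hφ, mul_one]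
    simp [Pi.single_apply, eq_comm]
  have h4 := volJ_mulVec_dotProduct_self φ
  have h5 := (volJ_mulVec_dotProduct_volJ φ φ).trans hφ
  have h6 := fun a => (dotProduct_comm _ _).trans (h1 a)
  have h7 := fun a => (dotProduct_comm _ _).trans (h2 a)
  have h8 := (dotProduct_comm _ _).trans h4
  rcases i with (i | i) | i <;> rcases j with (j | j) | j <;>
    simp [adaptedBasis, h1, h2, h3, h4, h5, h6, h7, h8, hφ, eq_iff_true_of_subsingleton]

/-- For a unit spinor `φ` the eight orthonormal spinors `φ`, `J φ`, `e_a · φ` span `Δ`. -/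
lemma eq_zero_of_dotProduct_adaptedBasis {φ χ : Spinor} (hφ : φ ⬝ᵥ φ = 1)
    (h : ∀ i, adaptedBasis φ i ⬝ᵥ χ = 0) : χ = 0 := by
  let U : Matrix ((Fin 1 ⊕ Fin 1) ⊕ Fin 6) (Fin 8) ℝ := Matrix.of (adaptedBasis φ)
  have h1 : U * Uᵀ = 1 := by
    ext i j
    rw [Matrix.one_apply]
    exact adaptedBasis_orthonormal hφ i j
  have h2 : Uᵀ * U = 1 := (Matrix.mul_eq_one_comm_of_card_eq _ _ _ (by simp)).1 h1
  have h3 : U *ᵥ χ = 0 := funext h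
  rw [← Matrix.one_mulVec χ, ← h2, ← Matrix.mulVec_mulVec, h3, Matrix.mulVec_zero]

/-- Every spinor orthogonal to `φ` and `J φ` is of the form `v · φ`. -/
lemma exists_cl_mulVec_eq {φ ψ : Spinor} (hφ : φ ⬝ᵥ φ = 1) (h1 : ψ ⬝ᵥ φ = 0)
    (h2 : ψ ⬝ᵥ (volJ *ᵥ φ) = 0) : ∃ v : Vec, ψ = cl v *ᵥ φ := by
  let v : Vec := fun a => (gamma a *ᵥ φ) ⬝ᵥ ψ
  refine ⟨v, sub_eq_zero.1 (eq_zero_of_dotProduct_adaptedBasis hφ ?_)⟩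
  rintro ((i | i) | a) <;> simp only [adaptedBasis, Sum.elim_inl, Sum.elim_inr, dotProduct_sub]
  · rw [dotProduct_comm, h1, dotProduct_comm, cl_mulVec_dotProduct_self, sub_zero]
  · rw [dotProduct_comm, h2, dotProduct_comm, cl_mulVec_dotProduct_volJ, sub_zero]
  · rw [← cl_single, cl_mulVec_dotProduct_cl, hφ]
    simp [v, cl_single]

/-- Any two unit spinors are related by Clifford multiplication by two unit vectors: there is a
unit spinor `χ` orthogonal to `φ`, `J φ`, `ψ` and `J ψ`, and then `χ = w · φ` and `ψ = v · χ`. -/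
lemma exists_cl_mul_cl_mulVec_eq {φ ψ : Spinor} (hφ : φ ⬝ᵥ φ = 1) (hψ : ψ ⬝ᵥ ψ = 1) :
    ∃ v w : Vec, v ⬝ᵥ v = 1 ∧ w ⬝ᵥ w = 1 ∧ ψ = (cl v * cl w) *ᵥ φ := by
  let K : Matrix (Fin 4) (Fin 8) ℝ := Matrix.of ![φ, volJ *ᵥ φ, ψ, volJ *ᵥ ψ]
  obtain ⟨χ, hχ, hχ0⟩ : ∃ χ ∈ LinearMap.ker K.mulVecLin, χ ≠ 0 :=
    Submodule.exists_mem_ne_zero_of_ne_bot (LinearMap.ker_ne_bot_of_finrank_lt (by simp))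
  have hK : K *ᵥ χ = 0 := by simpa using hχ
  have e0 : φ ⬝ᵥ χ = 0 := congrFun hK 0
  have e1 : (volJ *ᵥ φ) ⬝ᵥ χ = 0 := congrFun hK 1
  have e2 : ψ ⬝ᵥ χ = 0 := congrFun hK 2
  have e3 : (volJ *ᵥ ψ) ⬝ᵥ χ = 0 := congrFun hK 3
  have hpos : 0 < χ ⬝ᵥ χ :=
    lt_of_le_of_ne (Finset.sum_nonneg fun i _ => mul_self_nonneg (χ i))
      (fun h => hχ0 (dotProduct_self_eq_zero.1 h.symm))
  set r : ℝ := (Real.sqrt (χ ⬝ᵥ χ))⁻¹ with hr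
  have hrr : r * (r * (χ ⬝ᵥ χ)) = 1 := by
    have := Real.mul_self_sqrt hpos.le
    have h0 : Real.sqrt (χ ⬝ᵥ χ) ≠ 0 := (Real.sqrt_pos.2 hpos).ne'
    rw [hr]
    nth_rewrite 3 [← this]
    field_simp
  have hu : (r • χ) ⬝ᵥ (r • χ) = 1 := by
    rw [smul_dotProduct, dotProduct_smul, smul_eq_mul, smul_eq_mul, hrr]
  obtain ⟨w, hw⟩ := exists_cl_mulVec_eq (ψ := r • χ) hφ
    (by rw [smul_dotProduct, dotProduct_comm, e0, smul_zero])
    (by rw [smul_dotProduct, dotProduct_comm, e1, smul_zero])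
  obtain ⟨v, hv⟩ := exists_cl_mulVec_eq (ψ := ψ) hu
    (by rw [dotProduct_smul, e2, smul_zero])
    (by
      have := volJ_mulVec_dotProduct ψ χ
      rw [e3] at this
      rw [Matrix.mulVec_smul, dotProduct_smul, neg_eq_zero.1 this.symm, smul_zero])
  refine ⟨v, w, ?_, ?_, ?_⟩
  · have := cl_mulVec_dotProduct_cl v v (r • χ)
    rw [← hv, hψ, hu, mul_one] at this
    exact this.symm
  · have := cl_mulVec_dotProduct_cl w w φ
    rw [← hw, hu, hφ, mul_one] at this
    exact this.symm
  · rw [← Matrix.mulVec_mulVec, ← hw, ← hv]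

/-! ### Induced pairs -/

/-- If `S` is orthogonal, commutes with `J` and intertwines the Clifford multiplications `c` and
`c'`, then `φ` induces for `c` the same pair as `S φ` for `c'`. -/
lemma IsInducedPair.conj {V : Type*} {c c' : V → Matrix (Fin 8) (Fin 8) ℝ} {φ : Spinor}
    {J : V → V} {Om : V → V → V → ℝ} {S : Matrix (Fin 8) (Fin 8) ℝ}
    (hS : Sᵀ * S = 1) (hJ : S * volJ = volJ * S) (hc : ∀ X, c' X * S = S * c X)
    (h : IsInducedPair c φ J Om) : IsInducedPair c' (S *ᵥ φ) J Om := by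
  refine ⟨fun X => ?_, fun X Y Z => ?_⟩
  · rw [Matrix.mulVec_mulVec, hc, ← Matrix.mulVec_mulVec, h.1, Matrix.mulVec_mulVec (M := c' X),
      hc, Matrix.mulVec_mulVec, Matrix.mulVec_mulVec, Matrix.mulVec_mulVec, ← mul_assoc, hJ,
      mul_assoc]
  · have e : c' X * c' Y * c' Z * S = S * (c X * c Y * c Z) := by
      rw [mul_assoc, hc, mul_assoc, ← mul_assoc (c' Y), hc, mul_assoc, ← mul_assoc (c' X), hc]
      simp only [mul_assoc]
    rw [h.2, Matrix.mulVec_mulVec, e, ← Matrix.mulVec_mulVec φ S, mulVec_dotProduct_eq S,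
      Matrix.mulVec_mulVec φ Sᵀ, hS, Matrix.one_mulVec]

lemma IsInducedPair.neg {V : Type*} {c : V → Matrix (Fin 8) (Fin 8) ℝ} {φ : Spinor}
    {J : V → V} {Om : V → V → V → ℝ} (h : IsInducedPair c φ J Om) :
    IsInducedPair c (-φ) J Om := by
  refine ⟨fun X => ?_, fun X Y Z => ?_⟩
  · simp only [Matrix.mulVec_neg, h.1]
  · simp only [Matrix.mulVec_neg, h.2, neg_dotProduct_neg]

/-- A unit spinor induces at most one pair; here vectors act through their components `T X`. -/
lemma IsInducedPair.unique {V : Type*} {T : V → Vec} (hT : Function.Injective T) {φ : Spinor}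
    (hφ : φ ⬝ᵥ φ = 1) {J J' : V → V} {Om Om' : V → V → V → ℝ}
    (h : IsInducedPair (fun X => cl (T X)) φ J Om)
    (h' : IsInducedPair (fun X => cl (T X)) φ J' Om') : J = J' ∧ Om = Om' := by
  refine ⟨funext fun X => hT (cl_mulVec_injective hφ ((h.1 X).trans (h'.1 X).symm)), ?_⟩
  funext X Y Z
  rw [h.2, h'.2]

/-- The base point of the orbit: the first basis spinor induces the standard pair. -/
lemma isInducedPair_std :
    IsInducedPair cl (Pi.single 0 1) stdJ (fun X Y Z => stdOmega ![X, Y, Z]) := by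
  have hcol : ∀ X : Vec, cl X *ᵥ Pi.single 0 1 = ![0, 0, -X 4, X 5, -X 3, -X 2, -X 1, X 0] := by
    intro X
    ext p
    rw [Matrix.mulVec_single_one, Matrix.col_apply, cl_eq_sum]
    fin_cases p <;>
      simp [Matrix.sum_apply, Fin.sum_univ_six, gamma, gammaInt, rotE]
  refine ⟨fun X => ?_, fun X Y Z => ?_⟩
  · rw [hcol, hcol, volJ_eq_map]
    ext p
    fin_cases p <;>
      simp [stdJ, volJInt, rotE, Matrix.mulVec, dotProduct]
  · have e : ((cl X * cl Y * cl Z) *ᵥ (Pi.single 0 1 : Spinor)) ⬝ᵥ (Pi.single 0 1 : Spinor) =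
        -((cl Y *ᵥ (cl Z *ᵥ (Pi.single 0 1 : Spinor))) ⬝ᵥ (cl X *ᵥ (Pi.single 0 1 : Spinor))) := by
      rw [mul_assoc, ← Matrix.mulVec_mulVec, ← Matrix.mulVec_mulVec, cl_mulVec_dotProduct]
    rw [e, hcol, hcol, cl_eq_sum]
    simp [stdOmega, toC3, Matrix.det_fin_three, Matrix.mulVec, dotProduct, Fin.sum_univ_eight,
      Matrix.sum_apply, Fin.sum_univ_six, gamma, gammaInt, rotE]
    ring

/-! ### Lifting rotations to the spinors -/

/-- The orthogonal matrix `S` of `Δ` lifts the isometry `e` of `ℝ⁶`: `S · X · S⁻¹ = e X` for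
`X ∈ ℝ⁶`, and `S` commutes or anticommutes with `J` according to the sign of `det e`. -/
structure IsSpinorLift (e : E6 ≃ₗᵢ[ℝ] E6) (S : Matrix (Fin 8) (Fin 8) ℝ) : Prop where
  orthogonal : Sᵀ * S = 1
  mul_volJ : S * volJ = LinearMap.det (e.toLinearEquiv : E6 →ₗ[ℝ] E6) • (volJ * S)
  cl_mul (X : Vec) : cl (e (WithLp.toLp 2 X)).ofLp * S = S * cl X

lemma IsSpinorLift.one : IsSpinorLift 1 1 where
  orthogonal := by simp
  mul_volJ := by
    have : ((1 : E6 ≃ₗᵢ[ℝ] E6).toLinearEquiv : E6 →ₗ[ℝ] E6) = LinearMap.id := rfl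
    simp [this]
  cl_mul X := by simp

lemma IsSpinorLift.mul {e e' : E6 ≃ₗᵢ[ℝ] E6} {S S' : Matrix (Fin 8) (Fin 8) ℝ}
    (h : IsSpinorLift e S) (h' : IsSpinorLift e' S') : IsSpinorLift (e * e') (S * S') where
  orthogonal := by
    rw [Matrix.transpose_mul, mul_assoc, ← mul_assoc Sᵀ, h.orthogonal, one_mul, h'.orthogonal]
  mul_volJ := by
    have : ((e * e').toLinearEquiv : E6 →ₗ[ℝ] E6) =
      (e.toLinearEquiv : E6 →ₗ[ℝ] E6) ∘ₗ (e'.toLinearEquiv : E6 →ₗ[ℝ] E6) := rfl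
    rw [this, LinearMap.det_comp, mul_assoc, h'.mul_volJ, mul_smul_comm, ← mul_assoc, h.mul_volJ,
      smul_mul_assoc, smul_smul, mul_assoc, mul_comm]
  cl_mul X := by
    rw [← mul_assoc, LinearIsometryEquiv.coe_mul, Function.comp_apply]
    have := h.cl_mul (e' (WithLp.toLp 2 X)).ofLp
    rw [WithLp.toLp_ofLp] at this
    rw [this, mul_assoc, h'.cl_mul, mul_assoc]

/-- The reflection in the hyperplane orthogonal to a unit vector `v` is lifted by `J · v`. -/
lemma isSpinorLift_reflection {v : Vec} (hv : v ⬝ᵥ v = 1) :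
    IsSpinorLift (ℝ ∙ (WithLp.toLp 2 v : E6))ᗮ.reflection (volJ * cl v) where
  orthogonal := by
    rw [Matrix.transpose_mul, volJ_transpose, cl_transpose, neg_mul_neg, mul_assoc,
      ← mul_assoc volJ, volJ_mul_self, neg_one_mul, mul_neg, cl_mul_self, hv]
    simp
  mul_volJ := by
    have hv0 : (WithLp.toLp 2 v : E6) ≠ 0 := by
      intro h
      have : v = 0 := congrArg WithLp.ofLp h
      simp [this] at hv
    have hd : LinearMap.det ((ℝ ∙ (WithLp.toLp 2 v : E6))ᗮ.reflection.toLinearEquiv :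
        E6 →ₗ[ℝ] E6) = -1 := by
      rw [Submodule.det_reflection, Submodule.orthogonal_orthogonal, finrank_span_singleton hv0,
        pow_one]
    rw [hd, mul_assoc, cl_mul_volJ, mul_neg, neg_one_smul]
  cl_mul X := by
    have hr : ((ℝ ∙ (WithLp.toLp 2 v : E6))ᗮ.reflection (WithLp.toLp 2 X)).ofLp =
        X - (2 * (v ⬝ᵥ X)) • v := by
      have hn : ‖(WithLp.toLp 2 v : E6)‖ ^ 2 = 1 := by
        rw [EuclideanSpace.real_norm_sq_eq, ← hv]
        simp [dotProduct, sq]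
      rw [Submodule.reflection_orthogonal_apply, Submodule.reflection_singleton_apply]
      rw [RCLike.ofReal_real_eq_id, id_eq, hn]
      ext a
      simp [EuclideanSpace.inner_toLp_toLp, dotProduct_comm X]
      ring
    have h1 : cl X * cl v = (-2 * (v ⬝ᵥ X)) • (1 : Matrix (Fin 8) (Fin 8) ℝ) - cl v * cl X := by
      rw [← cl_mul_add_mul]; abel
    rw [hr, sub_eq_add_neg, cl_add, cl_neg, cl_smul, ← mul_assoc, add_mul, cl_mul_volJ, neg_mul,
      smul_mul_assoc, cl_mul_volJ, add_mul, neg_mul, neg_mul, smul_mul_assoc, neg_mul, mul_assoc,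
      mul_assoc, cl_mul_self, hv, h1, mul_sub, mul_assoc]
    simp

lemma isSpinorLift_reflection_orthogonal (v : E6) :
    ∃ S, IsSpinorLift (ℝ ∙ v)ᗮ.reflection S := by
  by_cases hv : v = 0
  · subst hv
    refine ⟨1, ?_⟩
    have : ((ℝ ∙ (0 : E6))ᗮ.reflection : E6 ≃ₗᵢ[ℝ] E6) = 1 := by
      ext x : 1
      rw [Submodule.reflection_mem_subspace_eq_self]
      · rfl
      · simp
    rw [this]
    exact IsSpinorLift.one
  · have hn : ‖v‖ ≠ 0 := norm_ne_zero_iff.2 hv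
    have hu : (‖v‖⁻¹ • v).ofLp ⬝ᵥ (‖v‖⁻¹ • v).ofLp = 1 := by
      have h1 : v.ofLp ⬝ᵥ v.ofLp = ‖v‖ ^ 2 := by
        rw [EuclideanSpace.real_norm_sq_eq]
        simp [dotProduct, sq]
      rw [WithLp.ofLp_smul, smul_dotProduct, dotProduct_smul, h1]
      simp only [smul_eq_mul]
      field_simp
    have hs : (ℝ ∙ (WithLp.toLp 2 (‖v‖⁻¹ • v).ofLp : E6)) = ℝ ∙ v := by
      rw [WithLp.toLp_ofLp]
      exact Submodule.span_singleton_smul_eq (IsUnit.mk0 _ (inv_ne_zero hn)) v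
    have h := isSpinorLift_reflection hu
    simp only [hs] at h
    exact ⟨_, h⟩

/-- Every isometry of `ℝ⁶` lifts to the spinors, since it is a product of reflections. -/
lemma exists_isSpinorLift (e : E6 ≃ₗᵢ[ℝ] E6) : ∃ S, IsSpinorLift e S := by
  obtain ⟨l, -, rfl⟩ := e.reflections_generate_dim
  induction l with
  | nil => exact ⟨1, IsSpinorLift.one⟩
  | cons v l ih =>
    obtain ⟨S, hS⟩ := ih
    obtain ⟨W, hW⟩ := isSpinorLift_reflection_orthogonal v
    exact ⟨W * S, by simpa using hW.mul hS⟩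

lemma SO6.transpose_mul_self (A : SO6) : A.1ᵀ * A.1 = 1 :=
  (Matrix.mem_orthogonalGroup_iff' (Fin 6) ℝ).1 (Matrix.mem_specialOrthogonalGroup_iff.1 A.2).1

lemma SO6.mul_transpose_self (A : SO6) : A.1 * A.1ᵀ = 1 :=
  (Matrix.mem_orthogonalGroup_iff (Fin 6) ℝ).1 (Matrix.mem_specialOrthogonalGroup_iff.1 A.2).1

lemma SO6.coe_inv (A : SO6) : (A⁻¹).1 = A.1ᵀ := rfl

lemma SO6.mulVec_inv_mulVec (A : SO6) (X : Vec) : A.1 *ᵥ ((A⁻¹).1 *ᵥ X) = X := by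
  rw [SO6.coe_inv, Matrix.mulVec_mulVec, SO6.mul_transpose_self, Matrix.one_mulVec]

lemma SO6.inv_mulVec_mulVec (A : SO6) (X : Vec) : (A⁻¹).1 *ᵥ (A.1 *ᵥ X) = X := by
  rw [SO6.coe_inv, Matrix.mulVec_mulVec, SO6.transpose_mul_self, Matrix.one_mulVec]

lemma SO6.dotProduct_mulVec (A : SO6) (X Y : Vec) : (A.1 *ᵥ X) ⬝ᵥ (A.1 *ᵥ Y) = X ⬝ᵥ Y := by
  rw [mulVec_dotProduct_eq, Matrix.mulVec_mulVec, SO6.transpose_mul_self, Matrix.one_mulVec]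

/-- Every rotation of `ℝ⁶` lifts to an orthogonal matrix of `Δ` commuting with `J`. -/
lemma SO6.exists_spinorLift (A : SO6) : ∃ S : Matrix (Fin 8) (Fin 8) ℝ, Sᵀ * S = 1 ∧
    S * volJ = volJ * S ∧ ∀ X : Vec, cl (A.1 *ᵥ X) * S = S * cl X := by
  let f : E6 →ₗᵢ[ℝ] E6 := (Matrix.toEuclideanLin A.1).isometryOfInner fun x y => by
    have := SO6.dotProduct_mulVec A y.ofLp x.ofLp
    simpa [EuclideanSpace.inner_eq_star_dotProduct] using this
  let e : E6 ≃ₗᵢ[ℝ] E6 := f.toLinearIsometryEquiv rfl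
  obtain ⟨S, hS⟩ := exists_isSpinorLift e
  have hd : LinearMap.det (e.toLinearEquiv : E6 →ₗ[ℝ] E6) = 1 := by
    have h1 : (e.toLinearEquiv : E6 →ₗ[ℝ] E6) = Matrix.toEuclideanLin A.1 := by
      ext; rfl
    rw [h1, Matrix.toEuclideanLin_eq_toLin_orthonormal, LinearMap.det_toLin]
    exact (Matrix.mem_specialOrthogonalGroup_iff.1 A.2).2
  refine ⟨S, hS.orthogonal, ?_, hS.cl_mul⟩
  rw [hS.mul_volJ, hd, one_smul]

/-- The conjugation by a product of two unit vectors is a rotation. -/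
lemma exists_SO6_cl_mul_cl {v w : Vec} (hv : v ⬝ᵥ v = 1) (hw : w ⬝ᵥ w = 1) :
    ∃ A : SO6, ∀ X, cl (A.1 *ᵥ X) * (cl v * cl w) = (cl v * cl w) * cl X := by
  have key : ∀ u : Vec, u ⬝ᵥ u = 1 → ∃ B : Matrix (Fin 6) (Fin 6) ℝ, Bᵀ = B ∧ B * B = 1 ∧
      B.det = -1 ∧ ∀ X, cl (B *ᵥ X) * cl u = cl u * cl X := by
    intro u hu
    -- `B X = -X + 2 (u, X) u` is minus a reflection, so its determinant is `-1`
    have hsq : Matrix.vecMulVec u u * Matrix.vecMulVec u u = Matrix.vecMulVec u u := by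
      rw [Matrix.vecMulVec_mul_vecMulVec, hu, one_smul]
    refine ⟨-(1 - (2 : ℝ) • Matrix.vecMulVec u u), ?_, ?_, ?_, fun X => ?_⟩
    · simp [Matrix.transpose_vecMulVec]
    · rw [neg_mul_neg, mul_sub, sub_mul, sub_mul, smul_mul_smul_comm, hsq]
      simp
      module
    · rw [Matrix.det_neg, Fintype.card_fin]
      have h := Matrix.det_one_add_replicateCol_mul_replicateRow (ι := Unit) ((-2 : ℝ) • u) u
      rw [← Matrix.vecMulVec_eq, Matrix.smul_vecMulVec, neg_smul, ← sub_eq_add_neg] at h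
      rw [h, dotProduct_smul, hu]
      norm_num
    · have h1 : cl u * cl X = (-2 * (u ⬝ᵥ X)) • (1 : Matrix (Fin 8) (Fin 8) ℝ) - cl X * cl u := by
        rw [← cl_mul_add_mul]; abel
      have h2 : -(1 - (2 : ℝ) • Matrix.vecMulVec u u) *ᵥ X = -X + (2 * (u ⬝ᵥ X)) • u := by
        rw [Matrix.neg_mulVec, Matrix.sub_mulVec, Matrix.one_mulVec, Matrix.smul_mulVec,
          Matrix.vecMulVec_mulVec]
        ext a
        simp
        ring
      rw [h2, cl_add, cl_neg, cl_smul, add_mul, neg_mul, smul_mul_assoc, cl_mul_self, hu, h1]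
      module
  obtain ⟨B, hB1, hB2, hB3, hB4⟩ := key v hv
  obtain ⟨C, hC1, hC2, hC3, hC4⟩ := key w hw
  refine ⟨⟨B * C, ?_⟩, fun X => ?_⟩
  · rw [Matrix.mem_specialOrthogonalGroup_iff, Matrix.mem_orthogonalGroup_iff]
    refine ⟨?_, by rw [Matrix.det_mul, hB3, hC3]; norm_num⟩
    change B * C * (B * C)ᵀ = 1
    rw [Matrix.transpose_mul, hB1, hC1, mul_assoc, ← mul_assoc C, hC2, one_mul, hB2]
  · change cl ((B * C) *ᵥ X) * _ = _
    rw [← Matrix.mulVec_mulVec, ← mul_assoc, hB4, mul_assoc, hC4, mul_assoc]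

lemma cl_mul_cl_orthogonal {v w : Vec} (hv : v ⬝ᵥ v = 1) (hw : w ⬝ᵥ w = 1) :
    (cl v * cl w)ᵀ * (cl v * cl w) = 1 := by
  rw [Matrix.transpose_mul, cl_transpose, cl_transpose, neg_mul_neg, mul_assoc, ← mul_assoc (cl v),
    cl_mul_self, hv, smul_mul_assoc, one_mul, mul_smul_comm, cl_mul_self, hw, smul_smul]
  simp

lemma cl_mul_cl_mul_volJ (v w : Vec) : cl v * cl w * volJ = volJ * (cl v * cl w) := by
  rw [mul_assoc, cl_mul_volJ, mul_neg, ← mul_assoc, cl_mul_volJ, neg_mul, neg_neg, mul_assoc]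

/-- Every unit spinor is obtained from the base spinor by a lift of a rotation. -/
lemma exists_SO6_lift_eq {φ : Spinor} (hφ : φ ⬝ᵥ φ = 1) :
    ∃ (A : SO6) (S : Matrix (Fin 8) (Fin 8) ℝ), Sᵀ * S = 1 ∧ S * volJ = volJ * S ∧
      (∀ X, cl (A.1 *ᵥ X) * S = S * cl X) ∧ φ = S *ᵥ Pi.single 0 1 := by
  obtain ⟨v, w, hv, hw, h⟩ := exists_cl_mul_cl_mulVec_eq (φ := Pi.single 0 1) (by simp) hφ
  obtain ⟨A, hA⟩ := exists_SO6_cl_mul_cl hv hw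
  exact ⟨A, cl v * cl w, cl_mul_cl_orthogonal hv hw, cl_mul_cl_mul_volJ v w, hA, h⟩

/-- If `S` lifts `A` then `S e₁` induces `A · (stdJ, stdOmega)`. -/
lemma isInducedPair_rot {A : SO6} {S : Matrix (Fin 8) (Fin 8) ℝ} (hS : Sᵀ * S = 1)
    (hJ : S * volJ = volJ * S) (hc : ∀ X, cl (A.1 *ᵥ X) * S = S * cl X) :
    IsInducedPair cl (S *ᵥ Pi.single 0 1) (rotJ A) (rotOmega A) := by
  refine IsInducedPair.conj (c := fun X => cl ((A⁻¹).1 *ᵥ X)) hS hJ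
    (fun X => by rw [← hc, SO6.mulVec_inv_mulVec]) ⟨fun X => ?_, fun X Y Z => ?_⟩
  · simp only [rotJ, SO6.inv_mulVec_mulVec]
    exact isInducedPair_std.1 _
  · exact isInducedPair_std.2 _ _ _

lemma exists_isInducedPair (A : SO6) :
    ∃ φ : Spinor, φ ⬝ᵥ φ = 1 ∧ IsInducedPair cl φ (rotJ A) (rotOmega A) := by
  obtain ⟨S, hS, hJ, hc⟩ := SO6.exists_spinorLift A
  refine ⟨S *ᵥ Pi.single 0 1, ?_, isInducedPair_rot hS hJ hc⟩
  rw [mulVec_dotProduct_eq, Matrix.mulVec_mulVec, hS, Matrix.one_mulVec]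
  simp

lemma exists_SO6_isInducedPair {φ : Spinor} (hφ : φ ⬝ᵥ φ = 1) :
    ∃ A : SO6, IsInducedPair cl φ (rotJ A) (rotOmega A) := by
  obtain ⟨A, S, hS, hJ, hc, rfl⟩ := exists_SO6_lift_eq hφ
  exact ⟨A, isInducedPair_rot hS hJ hc⟩

/-! ### Recovering a spinor from its three-form -/

/-- Each `e_a` permutes the basis of `Δ` up to signs: with indices read as binary numbers,
the permutation is the addition of a fixed bit pattern. In this form triple products of the `e_a`
are cheap to compute. -/
def gammaPerm (a : Fin 6) (q : Fin 8) : Fin 8 := (![7, 6, 5, 4, 2, 3] : Fin 6 → Fin 8) a ^^^ q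

/-- The sign in `e_a · ε_q = ± ε_{gammaPerm a q}`. -/
def gammaSign (a : Fin 6) (q : Fin 8) : ℤ := gammaInt a (gammaPerm a q) q

lemma gammaInt_apply (a : Fin 6) (p q : Fin 8) :
    gammaInt a p q = if p = gammaPerm a q then gammaSign a q else 0 := by
  have h : ∀ a : Fin 6, ∀ p q : Fin 8,
      gammaInt a p q - (if p = gammaPerm a q then gammaSign a q else 0) = 0 := by
    decide +kernel
  exact sub_eq_zero.1 (h a p q)

lemma gammaInt_mul_mul_apply (a b c : Fin 6) (p q : Fin 8) :
    (gammaInt a * gammaInt b * gammaInt c) p q =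
      if p = gammaPerm a (gammaPerm b (gammaPerm c q)) then
        gammaSign a (gammaPerm b (gammaPerm c q)) * gammaSign b (gammaPerm c q) * gammaSign c q
      else 0 := by
  simp [mul_assoc, Matrix.mul_apply, gammaInt_apply]

/-- The `3`-form of the first basis spinor `ε₁` has the components `-(e_a e_b e_c)₁₁`; contracted with
the matrices `e_a e_b e_c` it gives `-24 (ε₁ ε₁ᵀ - ε₂ ε₂ᵀ)`. -/
lemma sum_gammaInt_mul (p q : Fin 8) :
    ∑ a, ∑ b, ∑ c, (gammaInt a * gammaInt b * gammaInt c) 0 0 *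
      (gammaInt a * gammaInt b * gammaInt c) p q =
    if p = q then if p = 0 then 24 else if p = 1 then -24 else 0 else 0 := by
  simp_rw [gammaInt_mul_mul_apply]
  revert p q
  decide +kernel

/-- The action on spinors of the `3`-form `Om`, normalised by `-1/4`. -/
noncomputable def formMatrix (Om : Vec → Vec → Vec → ℝ) : Matrix (Fin 8) (Fin 8) ℝ :=
  (-(1 / 24) : ℝ) • ∑ a, ∑ b, ∑ c,
    Om (Pi.single a 1) (Pi.single b 1) (Pi.single c 1) • (gamma a * gamma b * gamma c)

/-- A polynomial in the `3`-form `Om`, equal to the rank-one projection `φ φᵀ` if `Om` is induced by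
the unit spinor `φ`. -/
noncomputable def spinorProj (Om : Vec → Vec → Vec → ℝ) : Matrix (Fin 8) (Fin 8) ℝ :=
  (1 / 2 : ℝ) • (formMatrix Om + formMatrix Om * formMatrix Om)

lemma formMatrix_std : formMatrix (fun X Y Z => stdOmega ![X, Y, Z]) =
    Matrix.vecMulVec (Pi.single 0 1) (Pi.single 0 1) -
      Matrix.vecMulVec (volJ *ᵥ Pi.single 0 1) (volJ *ᵥ Pi.single 0 1) := by
  have hg : ∀ a b c, gamma a * gamma b * gamma c =
      (gammaInt a * gammaInt b * gammaInt c).map (Int.cast : ℤ → ℝ) := fun a b c => by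
    have : gamma a * gamma b * gamma c =
      (Int.castRingHom ℝ).mapMatrix (gammaInt a * gammaInt b * gammaInt c) := by
      rw [map_mul, map_mul]
      rfl
    exact this
  have hO : ∀ a b c : Fin 6, stdOmega ![Pi.single a 1, Pi.single b 1, Pi.single c 1] =
      -(((gammaInt a * gammaInt b * gammaInt c) 0 0 : ℤ) : ℝ) := fun a b c => by
    have := isInducedPair_std.2 (Pi.single a 1) (Pi.single b 1) (Pi.single c 1)
    simp only [cl_single, hg] at this
    rw [this]
    simp
  have hJ : volJ *ᵥ Pi.single 0 1 = -Pi.single 1 1 := by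
    ext p
    rw [volJ_eq_map]
    fin_cases p <;> simp [volJInt, rotE]
  ext p q
  have h := congrArg (Int.cast : ℤ → ℝ) (sum_gammaInt_mul p q)
  push_cast at h
  simp only [formMatrix, hO, hg, Matrix.smul_apply, Matrix.sum_apply, Matrix.map_apply, neg_smul,
    Matrix.neg_apply, smul_eq_mul, Finset.sum_neg_distrib]
  rw [neg_mul_neg, h, hJ]
  simp only [Matrix.sub_apply, Matrix.vecMulVec_apply, Pi.neg_apply, Pi.single_apply]
  fin_cases p <;> fin_cases q <;> simp

/-- Contractions over an orthonormal basis do not depend on the basis. -/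
lemma SO6.sum_contraction (A : SO6) (l : Matrix (Fin 8) (Fin 8) ℝ →ₗ[ℝ] ℝ)
    (P Q : Matrix (Fin 8) (Fin 8) ℝ) :
    ∑ a, l (P * cl ((A⁻¹).1 *ᵥ Pi.single a 1) * Q) • (P * cl ((A⁻¹).1 *ᵥ Pi.single a 1) * Q) =
      ∑ a, l (P * gamma a * Q) • (P * gamma a * Q) := by
  have h1 : ∀ a, P * cl ((A⁻¹).1 *ᵥ Pi.single a 1) * Q = ∑ b, A.1 a b • (P * gamma b * Q) := by
    intro a
    rw [Matrix.mulVec_single_one, cl_eq_sum, Finset.mul_sum, Finset.sum_mul]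
    refine Finset.sum_congr rfl fun b _ => ?_
    rw [mul_smul_comm, smul_mul_assoc]
    rfl
  have h2 : ∀ b c, ∑ a, A.1 a b * A.1 a c = if b = c then 1 else 0 := fun b c => by
    have := congrFun (congrFun (SO6.transpose_mul_self A) b) c
    rwa [Matrix.mul_apply, Matrix.one_apply] at this
  simp_rw [h1, map_sum, map_smul, smul_eq_mul, Finset.sum_smul, Finset.smul_sum, smul_smul]
  rw [Finset.sum_comm]
  refine Finset.sum_congr rfl fun b _ => ?_
  rw [Finset.sum_comm]
  have h3 : ∀ c, ∑ a, (A.1 a b * l (P * gamma b * Q) * A.1 a c) • (P * gamma c * Q) =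
      ((if b = c then 1 else 0) * l (P * gamma b * Q)) • (P * gamma c * Q) := fun c => by
    rw [← Finset.sum_smul, ← h2, Finset.sum_mul]
    congr 1
    exact Finset.sum_congr rfl fun a _ => by ring
  simp_rw [h3]
  simp

/-- The threefold contraction over the rotated basis equals that over the standard basis. -/
lemma SO6.sum_contraction₃ (A : SO6) (l : Matrix (Fin 8) (Fin 8) ℝ →ₗ[ℝ] ℝ)
    {c : Fin 6 → Matrix (Fin 8) (Fin 8) ℝ} (hc : ∀ a, c a = cl ((A⁻¹).1 *ᵥ Pi.single a 1)) :
    ∑ a, ∑ b, ∑ d, l (c a * c b * c d) • (c a * c b * c d) =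
      ∑ a, ∑ b, ∑ d, l (gamma a * gamma b * gamma d) • (gamma a * gamma b * gamma d) := by
  -- the three contractions are replaced one after the other
  have h2 : ∀ P Q, ∑ d, l (P * c d * Q) • (P * c d * Q) =
    ∑ d, l (P * gamma d * Q) • (P * gamma d * Q) := fun P Q => by
      simp only [hc]
      exact SO6.sum_contraction A l P Q
  have h1 : ∀ P, ∑ d, l (P * c d) • (P * c d) = ∑ d, l (P * gamma d) • (P * gamma d) := fun P => by
    simpa only [mul_one] using h2 P 1
  have h3 : ∀ Q, ∑ d, l (c d * Q) • (c d * Q) = ∑ d, l (gamma d * Q) • (gamma d * Q) := fun Q => by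
    simpa only [one_mul] using h2 1 Q
  calc ∑ a, ∑ b, ∑ d, l (c a * c b * c d) • (c a * c b * c d)
      = ∑ a, ∑ b, ∑ d, l (c a * c b * gamma d) • (c a * c b * gamma d) :=
        Finset.sum_congr rfl fun a _ => Finset.sum_congr rfl fun b _ => h1 _
    _ = ∑ a, ∑ d, ∑ b, l (c a * c b * gamma d) • (c a * c b * gamma d) :=
        Finset.sum_congr rfl fun a _ => Finset.sum_comm
    _ = ∑ a, ∑ d, ∑ b, l (c a * gamma b * gamma d) • (c a * gamma b * gamma d) :=
        Finset.sum_congr rfl fun a _ => Finset.sum_congr rfl fun b _ => h2 _ _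
    _ = ∑ d, ∑ b, ∑ a, l (c a * gamma b * gamma d) • (c a * gamma b * gamma d) := by
        rw [Finset.sum_comm]
        exact Finset.sum_congr rfl fun a _ => Finset.sum_comm
    _ = ∑ d, ∑ b, ∑ a, l (gamma a * gamma b * gamma d) • (gamma a * gamma b * gamma d) := by
        refine Finset.sum_congr rfl fun d _ => Finset.sum_congr rfl fun b _ => ?_
        simp only [mul_assoc]
        exact h3 _
    _ = ∑ b, ∑ a, ∑ d, l (gamma a * gamma b * gamma d) • (gamma a * gamma b * gamma d) := by
        rw [Finset.sum_comm]
        exact Finset.sum_congr rfl fun a _ => Finset.sum_comm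
    _ = _ := Finset.sum_comm

/-- The standard form is a linear functional of `X · Y · Z`: minus the upper left entry. -/
lemma stdOmega_eq_entry (X Y Z : Vec) :
    stdOmega ![X, Y, Z] = (-Matrix.entryLinearMap ℝ ℝ 0 0) (cl X * cl Y * cl Z) := by
  have := isInducedPair_std.2 X Y Z
  simp only at this
  rw [this]
  simp

/-- The action of `3`-forms on spinors is equivariant. -/
lemma formMatrix_rotOmega_mul {A : SO6} {S : Matrix (Fin 8) (Fin 8) ℝ}
    (hc : ∀ X, cl (A.1 *ᵥ X) * S = S * cl X) :
    formMatrix (rotOmega A) * S = S * formMatrix (fun X Y Z => stdOmega ![X, Y, Z]) := by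
  obtain ⟨c, hcA⟩ : ∃ c : Fin 6 → Matrix (Fin 8) (Fin 8) ℝ,
    ∀ a, c a = cl ((A⁻¹).1 *ᵥ Pi.single a 1) := ⟨_, fun _ => rfl⟩
  have hO := stdOmega_eq_entry
  generalize -Matrix.entryLinearMap ℝ ℝ (0 : Fin 8) (0 : Fin 8) = l at hO
  have hS : ∀ a, gamma a * S = S * c a := fun a => by
    rw [← cl_single, ← SO6.mulVec_inv_mulVec A (Pi.single a 1), hc, hcA]
  have hS3 : ∀ a b d, gamma a * gamma b * gamma d * S = S * (c a * c b * c d) := fun a b d => by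
    rw [mul_assoc, hS, mul_assoc, ← mul_assoc (gamma b), hS, mul_assoc, ← mul_assoc (gamma a), hS]
    simp only [mul_assoc]
  have hL : formMatrix (rotOmega A) * S =
      S * ((-(1 / 24) : ℝ) • ∑ a, ∑ b, ∑ d, l (c a * c b * c d) • (c a * c b * c d)) := by
    simp only [formMatrix, rotOmega, hO, ← hcA, smul_mul_assoc, Finset.sum_mul, hS3, mul_smul_comm,
      Finset.mul_sum]
  rw [hL, SO6.sum_contraction₃ A l hcA]
  simp only [formMatrix, hO, cl_single]

lemma formMatrix_eq {φ : Spinor} {J : Vec → Vec} {Om : Vec → Vec → Vec → ℝ} (hφ : φ ⬝ᵥ φ = 1)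
    (h : IsInducedPair cl φ J Om) :
    formMatrix Om = Matrix.vecMulVec φ φ - Matrix.vecMulVec (volJ *ᵥ φ) (volJ *ᵥ φ) := by
  obtain ⟨A, S, hS, hJ, hc, rfl⟩ := exists_SO6_lift_eq hφ
  have h' := isInducedPair_rot hS hJ hc
  have hO : Om = rotOmega A := by
    funext X Y Z
    rw [h.2, h'.2]
  have hS' : S * Sᵀ = 1 := mul_eq_one_comm.1 hS
  have h1 := congrArg (· * Sᵀ) (formMatrix_rotOmega_mul hc)
  simp only [mul_assoc, hS', mul_one] at h1
  have hv : ∀ x y : Spinor, S * (Matrix.vecMulVec x y * Sᵀ) =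
      Matrix.vecMulVec (S *ᵥ x) (S *ᵥ y) := fun x y => by
    rw [Matrix.vecMulVec_mul, Matrix.mul_vecMulVec, Matrix.vecMul_transpose]
  rw [hO, h1, formMatrix_std, sub_mul, mul_sub, hv, hv, Matrix.mulVec_mulVec, hJ,
    ← Matrix.mulVec_mulVec]

/-- On the orthonormal spinors `φ`, `J φ` the form acts as `1`, `-1`, and it kills their
complement; hence the projection to `φ`. -/
lemma spinorProj_eq {φ : Spinor} {J : Vec → Vec} {Om : Vec → Vec → Vec → ℝ} (hφ : φ ⬝ᵥ φ = 1)
    (h : IsInducedPair cl φ J Om) : spinorProj Om = Matrix.vecMulVec φ φ := by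
  have h1 := (volJ_mulVec_dotProduct_volJ φ φ).trans hφ
  have h2 := volJ_mulVec_dotProduct_self φ
  have h3 : φ ⬝ᵥ (volJ *ᵥ φ) = 0 := (dotProduct_comm _ _).trans h2
  rw [spinorProj, formMatrix_eq hφ h, sub_mul, mul_sub, mul_sub]
  simp only [Matrix.vecMulVec_mul_vecMulVec, h1, h2, h3, hφ, one_smul, zero_smul,
    Matrix.vecMulVec_zero]
  module

lemma vecMulVec_self_injective {n : Type*} [Fintype n] {x y : n → ℝ} (hx : x ⬝ᵥ x = 1)
    (h : Matrix.vecMulVec x x = Matrix.vecMulVec y y) : y = x ∨ y = -x := by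
  have h1 : ∀ p q, x p * x q = y p * y q := fun p q => congrFun (congrFun h p) q
  have h2 : x = (y ⬝ᵥ x) • y := by
    funext p
    have : x p * (x ⬝ᵥ x) = y p * (y ⬝ᵥ x) := by
      simp only [dotProduct, Finset.mul_sum]
      exact Finset.sum_congr rfl fun q _ => by rw [← mul_assoc, h1, mul_assoc]
    rw [hx, mul_one] at this
    rw [this, Pi.smul_apply, smul_eq_mul, mul_comm]
  have h3 : (y ⬝ᵥ x) * (y ⬝ᵥ x) = 1 := by
    nth_rewrite 1 [← smul_eq_mul, ← smul_dotProduct, ← h2]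
    exact hx
  rcases mul_self_eq_one_iff.1 h3 with h4 | h4
  · left; rw [h2, h4, one_smul]
  · right; rw [h2, h4, neg_one_smul, neg_neg]

/-- Two unit spinors inducing the same `3`-form agree up to sign. -/
lemma IsInducedPair.eq_or_eq_neg {φ ψ : Spinor} {J J' : Vec → Vec} {Om : Vec → Vec → Vec → ℝ}
    (hφ : φ ⬝ᵥ φ = 1) (hψ : ψ ⬝ᵥ ψ = 1) (h : IsInducedPair cl φ J Om)
    (h' : IsInducedPair cl ψ J' Om) : ψ = φ ∨ ψ = -φ :=
  vecMulVec_self_injective hφ (by rw [← spinorProj_eq hφ h, ← spinorProj_eq hψ h'])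

/-! ### The stabilizer of the standard pair -/

lemma toC3_add (x y : Vec) : toC3 (x + y) = toC3 x + toC3 y := by
  ext k
  fin_cases k <;> apply Complex.ext <;> simp [toC3]

/-- The inverse of `toC3`. -/
def fromC3 (z : Fin 3 → ℂ) : Vec :=
  ![(z 0).re, (z 0).im, (z 1).re, (z 1).im, (z 2).re, (z 2).im]

lemma toC3_fromC3 (z : Fin 3 → ℂ) : toC3 (fromC3 z) = z := by
  ext k
  fin_cases k <;> apply Complex.ext <;> simp [toC3, fromC3]

lemma fromC3_toC3 (x : Vec) : fromC3 (toC3 x) = x :=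
  toC3_injective (toC3_fromC3 _)

lemma toC3_smul_sub_smul_stdJ (a b : ℝ) (x : Vec) :
    toC3 (a • x - b • stdJ x) = (a + b * Complex.I) • toC3 x := by
  ext k
  fin_cases k <;> apply Complex.ext <;> simp [toC3, stdJ]

/-- The Hermitian form of `ℂ³` in terms of the inner product of `ℝ⁶` and `stdJ`. -/
lemma star_toC3_dotProduct (x y : Vec) :
    star (toC3 x) ⬝ᵥ toC3 y = ⟨x ⬝ᵥ y, x ⬝ᵥ stdJ y⟩ := by
  apply Complex.ext <;>
    simp [toC3, stdJ, dotProduct, Fin.sum_univ_three, Fin.sum_univ_six] <;> ring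

/-- Complex linear maps multiply `dz₁ ∧ dz₂ ∧ dz₃` by their determinant. -/
lemma det_toC3_mulVec {A : Matrix (Fin 6) (Fin 6) ℝ} {U : Matrix (Fin 3) (Fin 3) ℂ}
    (h : ∀ x, toC3 (A *ᵥ x) = U *ᵥ toC3 x) (x : Fin 3 → Vec) :
    (Matrix.of fun l k => toC3 (A *ᵥ x l) k).det =
      (Matrix.of fun l k => toC3 (x l) k).det * U.det := by
  rw [← Matrix.det_transpose U, ← Matrix.det_mul]
  congr 1
  ext l k
  simp [h, Matrix.mul_apply, Matrix.mulVec, dotProduct, mul_comm]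

/-- `SU(3)` consists of the rotations that preserve `stdJ`, hence are complex linear and unitary,
and `stdOmega`, hence have complex determinant one. -/
lemma mem_SU3_iff_preserves (A : SO6) :
    A ∈ SU3 ↔ (∀ x, A.1 *ᵥ stdJ x = stdJ (A.1 *ᵥ x)) ∧
      ∀ X Y Z, stdOmega ![A.1 *ᵥ X, A.1 *ᵥ Y, A.1 *ᵥ Z] = stdOmega ![X, Y, Z] := by
  have hcons : ∀ X Y Z : Vec, ![A.1 *ᵥ X, A.1 *ᵥ Y, A.1 *ᵥ Z] = fun l => A.1 *ᵥ ![X, Y, Z] l := by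
    intro X Y Z
    funext l
    fin_cases l <;> rfl
  constructor
  · rintro ⟨U, hU, h⟩
    refine ⟨fun x => toC3_injective ?_, fun X Y Z => ?_⟩
    · rw [h, toC3_stdJ, toC3_stdJ, h, Matrix.mulVec_smul]
    · rw [hcons, stdOmega, det_toC3_mulVec h, (Matrix.mem_specialUnitaryGroup_iff.1 hU).2, mul_one]
      rfl
  · rintro ⟨hJ, hO⟩
    let L : (Fin 3 → ℂ) →ₗ[ℂ] (Fin 3 → ℂ) :=
      { toFun := fun z => toC3 (A.1 *ᵥ fromC3 z)
        map_add' := fun z w => by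
          have : fromC3 (z + w) = fromC3 z + fromC3 w := toC3_injective (by
            rw [toC3_add, toC3_fromC3, toC3_fromC3, toC3_fromC3])
          rw [this, Matrix.mulVec_add, toC3_add]
        map_smul' := fun c z => by
          have : fromC3 (c • z) = c.re • fromC3 z - c.im • stdJ (fromC3 z) := toC3_injective (by
            rw [toC3_fromC3, toC3_smul_sub_smul_stdJ, toC3_fromC3, Complex.re_add_im])
          rw [this, Matrix.mulVec_sub, Matrix.mulVec_smul, Matrix.mulVec_smul, hJ,
            toC3_smul_sub_smul_stdJ, Complex.re_add_im]
          rfl }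
    have hL : ∀ x, toC3 (A.1 *ᵥ x) = LinearMap.toMatrix' L *ᵥ toC3 x := fun x => by
      rw [LinearMap.toMatrix'_mulVec]
      change _ = toC3 (A.1 *ᵥ fromC3 (toC3 x))
      rw [fromC3_toC3]
    set U := LinearMap.toMatrix' L with hUdef
    refine ⟨U, ?_, hL⟩
    rw [Matrix.mem_specialUnitaryGroup_iff, Matrix.mem_unitaryGroup_iff']
    constructor
    · have h1 : ∀ z w : Fin 3 → ℂ, star (U *ᵥ z) ⬝ᵥ (U *ᵥ w) = star z ⬝ᵥ w := fun z w => by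
        rw [← toC3_fromC3 z, ← toC3_fromC3 w, ← hL, ← hL, star_toC3_dotProduct,
          star_toC3_dotProduct, ← hJ, SO6.dotProduct_mulVec, SO6.dotProduct_mulVec]
      refine Matrix.ext_of_mulVec_single fun k => ?_
      refine dotProduct_eq _ _ fun z => ?_
      rw [dotProduct_comm, dotProduct_comm _ z, Matrix.one_mulVec, ← Matrix.mulVec_mulVec,
        Matrix.dotProduct_mulVec, ← star_star z, ← h1, Matrix.star_mulVec]
      rfl
    · -- evaluate the form on the complex basis and on its multiple by `i`
      have h2 : ∀ X Y Z, ((Matrix.of fun l k => toC3 (![X, Y, Z] l) k).det * U.det).re =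
          ((Matrix.of fun l k => toC3 (![X, Y, Z] l) k).det).re := fun X Y Z => by
        rw [← det_toC3_mulVec hL, ← stdOmega, ← stdOmega, ← hcons, hO]
      have hre := h2 (fromC3 ![1, 0, 0]) (fromC3 ![0, 1, 0]) (fromC3 ![0, 0, 1])
      have him := h2 (fromC3 ![Complex.I, 0, 0]) (fromC3 ![0, 1, 0]) (fromC3 ![0, 0, 1])
      have d1 : (Matrix.of fun l k => toC3 ((![fromC3 ![1, 0, 0], fromC3 ![0, 1, 0],
          fromC3 ![0, 0, 1]] : Fin 3 → Vec) l) k).det = 1 := by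
        simp [Matrix.det_fin_three, toC3_fromC3]
      have d2 : (Matrix.of fun l k => toC3 ((![fromC3 ![Complex.I, 0, 0], fromC3 ![0, 1, 0],
          fromC3 ![0, 0, 1]] : Fin 3 → Vec) l) k).det = Complex.I := by
        simp [Matrix.det_fin_three, toC3_fromC3]
      rw [d1] at hre
      rw [d2] at him
      exact Complex.ext (by simpa using hre) (by simpa using him)

lemma rotJ_mul (A C : SO6) (X : Vec) : rotJ (A * C) X = A.1 *ᵥ rotJ C ((A⁻¹).1 *ᵥ X) := by
  have h1 : (A * C).1 = A.1 * C.1 := rfl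
  have h2 : ((A * C)⁻¹).1 = (C⁻¹).1 * (A⁻¹).1 := by rw [mul_inv_rev]; rfl
  simp only [rotJ, h1, h2, Matrix.mulVec_mulVec]

lemma rotOmega_mul (A C : SO6) (X Y Z : Vec) : rotOmega (A * C) X Y Z =
    rotOmega C ((A⁻¹).1 *ᵥ X) ((A⁻¹).1 *ᵥ Y) ((A⁻¹).1 *ᵥ Z) := by
  have h2 : ((A * C)⁻¹).1 = (C⁻¹).1 * (A⁻¹).1 := by rw [mul_inv_rev]; rfl
  simp only [rotOmega, h2, Matrix.mulVec_mulVec]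

/-- The stabilizer of the standard pair is `SU(3)`. -/
lemma mem_SU3_iff (A : SO6) :
    A ∈ SU3 ↔ rotJ A = stdJ ∧ rotOmega A = fun X Y Z => stdOmega ![X, Y, Z] := by
  rw [mem_SU3_iff_preserves]
  refine and_congr ⟨fun h => ?_, fun h x => ?_⟩ ⟨fun h => ?_, fun h X Y Z => ?_⟩
  · funext X
    rw [rotJ, h, SO6.mulVec_inv_mulVec]
  · rw [← congrFun h (A.1 *ᵥ x), rotJ, SO6.inv_mulVec_mulVec]
  · funext X Y Z
    rw [rotOmega, ← h, SO6.mulVec_inv_mulVec, SO6.mulVec_inv_mulVec, SO6.mulVec_inv_mulVec]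
  · have := congrFun (congrFun (congrFun h (A.1 *ᵥ X)) (A.1 *ᵥ Y)) (A.1 *ᵥ Z)
    rw [← this, rotOmega, SO6.inv_mulVec_mulVec, SO6.inv_mulVec_mulVec, SO6.inv_mulVec_mulVec]

lemma rot_eq_rot_iff (A B : SO6) :
    A⁻¹ * B ∈ SU3 ↔ rotJ A = rotJ B ∧ rotOmega A = rotOmega B := by
  obtain ⟨C, rfl⟩ : ∃ C, B = A * C := ⟨A⁻¹ * B, by group⟩
  have hi : Function.Surjective fun X : Vec => (A⁻¹).1 *ᵥ X :=
    fun X => ⟨A.1 *ᵥ X, SO6.inv_mulVec_mulVec A X⟩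
  have hi' : Function.Injective fun X : Vec => A.1 *ᵥ X :=
    Function.LeftInverse.injective (SO6.inv_mulVec_mulVec A)
  rw [inv_mul_cancel_left, mem_SU3_iff]
  constructor
  · rintro ⟨h1, h2⟩
    refine ⟨?_, ?_⟩
    · funext X
      rw [rotJ_mul, h1, rotJ]
    · funext X Y Z
      rw [rotOmega_mul, h2, rotOmega]
  · rintro ⟨h1, h2⟩
    refine ⟨?_, ?_⟩
    · funext X
      obtain ⟨X, rfl⟩ := hi X
      have := congrFun h1 X
      rw [rotJ_mul, rotJ] at this
      exact (hi' this).symm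
    · funext X Y Z
      obtain ⟨X, rfl⟩ := hi X
      obtain ⟨Y, rfl⟩ := hi Y
      obtain ⟨Z, rfl⟩ := hi Z
      have := congrFun (congrFun (congrFun h2 X) Y) Z
      rw [rotOmega_mul, rotOmega] at this
      exact this.symm

/-! ### The homeomorphism `SO(6)/SU(3) ≃ ℝℙ⁷` -/

lemma continuous_cl : Continuous cl := by
  have : cl = fun v => ∑ a, v a • gamma a := funext cl_eq_sum
  rw [this]
  fun_prop

lemma continuous_formMatrix_rotOmega : Continuous fun A : SO6 => formMatrix (rotOmega A) := by
  have hA : ∀ X : Vec, Continuous fun A : SO6 => cl ((A⁻¹).1 *ᵥ X) := fun X =>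
    continuous_cl.comp (Continuous.matrix_mulVec
      (Continuous.matrix_transpose continuous_subtype_val) continuous_const)
  have hl : Continuous ⇑(-Matrix.entryLinearMap ℝ ℝ (0 : Fin 8) (0 : Fin 8) :
      Matrix (Fin 8) (Fin 8) ℝ →ₗ[ℝ] ℝ) := LinearMap.continuous_of_finiteDimensional _
  have h : ∀ X Y Z, Continuous fun A : SO6 => rotOmega A X Y Z := fun X Y Z => by
    simp only [rotOmega, stdOmega_eq_entry]
    exact Continuous.comp hl (((hA X).mul (hA Y)).mul (hA Z))
  refine Continuous.const_smul (g := fun A : SO6 => ∑ a, ∑ b, ∑ c, rotOmega A (Pi.single a 1)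
    (Pi.single b 1) (Pi.single c 1) • (gamma a * gamma b * gamma c)) ?_ (-(1 / 24) : ℝ)
  exact continuous_finsetSum _ fun a _ => continuous_finsetSum _ fun b _ =>
    continuous_finsetSum _ fun c _ => (h _ _ _).smul continuous_const

lemma continuous_spinorProj_rotOmega : Continuous fun A : SO6 => spinorProj (rotOmega A) :=
  Continuous.const_smul (continuous_formMatrix_rotOmega.add
    (continuous_formMatrix_rotOmega.mul continuous_formMatrix_rotOmega)) (1 / 2 : ℝ)

instance : CompactSpace SO6 := by
  suffices h : IsCompact (Matrix.specialOrthogonalGroup (Fin 6) ℝ : Set (Matrix (Fin 6) (Fin 6) ℝ))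
    from isCompact_iff_compactSpace.1 h
  have hset : ((Matrix.specialOrthogonalGroup (Fin 6) ℝ : Set (Matrix (Fin 6) (Fin 6) ℝ))) =
      {A | A * Aᵀ = 1 ∧ A.det = 1} := by
    ext A
    rw [SetLike.mem_coe, Matrix.mem_specialOrthogonalGroup_iff, Matrix.mem_orthogonalGroup_iff]
    rfl
  have hclosed : IsClosed {A : Matrix (Fin 6) (Fin 6) ℝ | A * Aᵀ = 1 ∧ A.det = 1} :=
    (isClosed_eq (by fun_prop) continuous_const).inter
      (isClosed_eq (by fun_prop) continuous_const)
  have hbox : IsCompact (Set.pi Set.univ fun _ : Fin 6 => Set.pi Set.univ fun _ : Fin 6 =>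
      Set.Icc (-1 : ℝ) 1) :=
    isCompact_univ_pi fun _ => isCompact_univ_pi fun _ => isCompact_Icc
  rw [hset]
  refine hbox.of_isClosed_subset hclosed fun (A : Matrix (Fin 6) (Fin 6) ℝ) hA a _ b _ => ?_
  have h1 : ∑ c, A a c * A a c = 1 := by
    have := congrFun (congrFun hA.1 a) a
    rwa [Matrix.mul_apply, Matrix.one_apply_eq] at this
  have h2 : A a b * A a b ≤ 1 := h1 ▸ Finset.single_le_sum
    (f := fun c => A a c * A a c) (fun c _ => mul_self_nonneg _) (Finset.mem_univ b)
  exact abs_le.1 (abs_le_one_iff_mul_self_le_one.2 h2)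

lemma continuous_projectivization_mk :
    Continuous fun v : {v : Spinor // v ≠ 0} => Projectivization.mk ℝ v.1 v.2 :=
  continuous_quotient_mk'

instance : CompactSpace (ℙ ℝ Spinor) := by
  have : CompactSpace (Metric.sphere (0 : Spinor) 1) :=
    isCompact_iff_compactSpace.1 (isCompact_sphere 0 1)
  let f : Metric.sphere (0 : Spinor) 1 → ℙ ℝ Spinor := fun v =>
    Projectivization.mk ℝ v.1 (ne_zero_of_mem_unit_sphere v)
  have hf : Continuous f := continuous_projectivization_mk.comp
    (f := fun v : Metric.sphere (0 : Spinor) 1 =>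
      (⟨v.1, ne_zero_of_mem_unit_sphere v⟩ : {v : Spinor // v ≠ 0}))
    (continuous_subtype_val.subtype_mk _)
  have hs : Function.Surjective f := fun p => by
    induction p using Projectivization.ind with
    | h v hv =>
      have hn : ‖v‖ ≠ 0 := norm_ne_zero_iff.2 hv
      refine ⟨⟨‖v‖⁻¹ • v, by simp [norm_smul, hn]⟩, ?_⟩
      rw [Projectivization.mk_eq_mk_iff']
      exact ⟨‖v‖⁻¹, rfl⟩
  exact hs.compactSpace hf

/-- The embedding `[φ] ↦ φ φᵀ / |φ|²` of projective space into the matrices. -/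
noncomputable def lineProj : ℙ ℝ Spinor → Matrix (Fin 8) (Fin 8) ℝ :=
  Projectivization.lift (fun v => (v.1 ⬝ᵥ v.1)⁻¹ • Matrix.vecMulVec v.1 v.1) (by
    rintro ⟨v, hv⟩ ⟨w, hw⟩ t (rfl : v = t • w)
    have ht : t ≠ 0 := by
      rintro rfl
      simp at hv
    have hw' : w ⬝ᵥ w ≠ 0 := fun h => hw (dotProduct_self_eq_zero.1 h)
    simp only [smul_dotProduct, dotProduct_smul, Matrix.smul_vecMulVec, Matrix.vecMulVec_smul,
      smul_smul, smul_eq_mul]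
    congr 1
    field_simp)

lemma lineProj_mk {φ : Spinor} (hφ : φ ⬝ᵥ φ = 1) :
    lineProj (Projectivization.mk ℝ φ (Spinor.ne_zero hφ)) = Matrix.vecMulVec φ φ := by
  rw [lineProj, Projectivization.lift_mk, hφ, inv_one, one_smul]

lemma exists_unit_mk (p : ℙ ℝ Spinor) : ∃ (φ : Spinor) (hφ : φ ⬝ᵥ φ = 1),
    p = Projectivization.mk ℝ φ (Spinor.ne_zero hφ) := by
  induction p using Projectivization.ind with
  | h v hv =>
    have hpos : 0 < v ⬝ᵥ v := lt_of_le_of_ne (Finset.sum_nonneg fun i _ => mul_self_nonneg (v i))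
      (fun h => hv (dotProduct_self_eq_zero.1 h.symm))
    have h0 : Real.sqrt (v ⬝ᵥ v) ≠ 0 := (Real.sqrt_pos.2 hpos).ne'
    have hs := Real.mul_self_sqrt hpos.le
    refine ⟨(Real.sqrt (v ⬝ᵥ v))⁻¹ • v, ?_, ?_⟩
    · rw [smul_dotProduct, dotProduct_smul, smul_eq_mul, smul_eq_mul]
      nth_rewrite 3 [← hs]
      field_simp
    · rw [Projectivization.mk_eq_mk_iff']
      refine ⟨Real.sqrt (v ⬝ᵥ v), ?_⟩
      rw [smul_smul, mul_inv_cancel₀ h0, one_smul]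

lemma mk_eq_mk_of_eq_or_eq_neg {φ ψ : Spinor} (hφ : φ ⬝ᵥ φ = 1) (hψ : ψ ⬝ᵥ ψ = 1)
    (h : ψ = φ ∨ ψ = -φ) : Projectivization.mk ℝ φ (Spinor.ne_zero hφ) =
      Projectivization.mk ℝ ψ (Spinor.ne_zero hψ) := by
  rw [Projectivization.mk_eq_mk_iff']
  rcases h with rfl | rfl
  · exact ⟨1, one_smul _ _⟩
  · exact ⟨-1, by simp⟩

lemma lineProj_injective : Function.Injective lineProj := by
  intro p q h
  obtain ⟨φ, hφ, rfl⟩ := exists_unit_mk p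
  obtain ⟨ψ, hψ, rfl⟩ := exists_unit_mk q
  rw [lineProj_mk hφ, lineProj_mk hψ] at h
  exact mk_eq_mk_of_eq_or_eq_neg hφ hψ (vecMulVec_self_injective hφ h)

lemma continuous_lineProj : Continuous lineProj := by
  refine Continuous.quotient_lift (s := projectivizationSetoid ℝ Spinor) (f := fun v =>
    (v.1 ⬝ᵥ v.1)⁻¹ • Matrix.vecMulVec v.1 v.1) ?_ _
  have h1 : Continuous fun v : {v : Spinor // v ≠ 0} => v.1 ⬝ᵥ v.1 :=
    Continuous.dotProduct continuous_subtype_val continuous_subtype_val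
  refine (h1.inv₀ fun v h => v.2 (dotProduct_self_eq_zero.1 h)).smul ?_
  exact Continuous.matrix_vecMulVec continuous_subtype_val continuous_subtype_val

instance : T2Space (ℙ ℝ Spinor) := .of_injective_continuous lineProj_injective continuous_lineProj

/-- A pair induced by one of two unit spinors on the same line is induced by the other. -/
lemma IsInducedPair.of_mk_eq {V : Type*} {c : V → Matrix (Fin 8) (Fin 8) ℝ} {φ ψ : Spinor}
    {J : V → V} {Om : V → V → V → ℝ} (hφ : φ ⬝ᵥ φ = 1) (hψ : ψ ⬝ᵥ ψ = 1)
    (h : IsInducedPair c φ J Om) (he : Projectivization.mk ℝ φ (Spinor.ne_zero hφ) =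
      Projectivization.mk ℝ ψ (Spinor.ne_zero hψ)) : IsInducedPair c ψ J Om := by
  have h1 := congrArg lineProj he
  rw [lineProj_mk hφ, lineProj_mk hψ] at h1
  rcases vecMulVec_self_injective hφ h1 with rfl | rfl
  exacts [h, h.neg]

/-- The map sending the coset of `A` to the line of the spinors inducing `A · (stdJ, stdOmega)` is a
continuous bijection from a compact to a Hausdorff space. -/
theorem exists_homeomorph : ∃ Φ : (SO6 ⧸ SU3) ≃ₜ ℙ ℝ Spinor,
    ∀ (A : SO6) (φ : Spinor) (hφ : φ ⬝ᵥ φ = 1),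
      Φ (A : SO6 ⧸ SU3) = Projectivization.mk ℝ φ (Spinor.ne_zero hφ) ↔
        IsInducedPair cl φ (rotJ A) (rotOmega A) := by
  choose φ hφ hI using exists_isInducedPair
  let f : SO6 → ℙ ℝ Spinor := fun A => Projectivization.mk ℝ (φ A) (Spinor.ne_zero (hφ A))
  have key : ∀ (A : SO6) (ψ : Spinor) (hψ : ψ ⬝ᵥ ψ = 1),
      f A = Projectivization.mk ℝ ψ (Spinor.ne_zero hψ) ↔
        IsInducedPair cl ψ (rotJ A) (rotOmega A) := fun A ψ hψ =>
    ⟨fun h => (hI A).of_mk_eq (hφ A) hψ h, fun h =>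
      mk_eq_mk_of_eq_or_eq_neg (hφ A) hψ ((hI A).eq_or_eq_neg (hφ A) hψ h)⟩
  have hf : ∀ A B, f A = f B ↔ A⁻¹ * B ∈ SU3 := fun A B => by
    rw [rot_eq_rot_iff, key A (φ B) (hφ B)]
    constructor
    · intro h
      exact IsInducedPair.unique (T := id) Function.injective_id (hφ B) h (hI B)
    · rintro ⟨h1, h2⟩
      rw [h1, h2]
      exact hI B
  let F : SO6 ⧸ SU3 → ℙ ℝ Spinor := Quotient.lift f fun A B h =>
    (hf A B).2 (QuotientGroup.leftRel_apply.1 h)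
  have hbij : Function.Bijective F := by
    constructor
    · intro p q
      induction p using QuotientGroup.induction_on
      induction q using QuotientGroup.induction_on
      intro h
      exact QuotientGroup.eq.2 ((hf _ _).1 h)
    · intro p
      obtain ⟨ψ, hψ, rfl⟩ := exists_unit_mk p
      obtain ⟨A, hA⟩ := exists_SO6_isInducedPair hψ
      exact ⟨(A : SO6 ⧸ SU3), (key A ψ hψ).2 hA⟩
  -- `lineProj` embeds the compact space `ℝℙ⁷` in the matrices, so that continuity may be
  -- checked after composition with it, where it is that of `spinorProj`
  have hcont : Continuous F := by
    have hemb := (continuous_lineProj.isClosedEmbedding lineProj_injective).isInducing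
    have hfc : (fun A => lineProj (f A)) = fun A => spinorProj (rotOmega A) := funext fun A => by
      rw [lineProj_mk (hφ A), spinorProj_eq (hφ A) (hI A)]
    have hfcont : Continuous f := by
      rw [hemb.continuous_iff, Function.comp_def, hfc]
      exact continuous_spinorProj_rotOmega
    exact hfcont.quotient_lift _
  exact ⟨Continuous.homeoOfEquivCompactToT2 (f := Equiv.ofBijective F hbij) hcont, key⟩

/-! ### The spin representation -/

lemma rep_ι (v : Vec) : rep (CliffordAlgebra.ι negSq v) = cl v := rfl

/-- The representation turns the anti-involution with `v ↦ -v` into transposition. -/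
lemma rep_star (x : CliffordAlgebra negSq) : rep (star x) = (rep x)ᵀ := by
  induction x using CliffordAlgebra.induction with
  | algebraMap r => simp [CliffordAlgebra.star_algebraMap, Matrix.algebraMap_eq_diagonal]
  | ι v => rw [CliffordAlgebra.star_ι, map_neg, rep_ι, cl_transpose]
  | mul a b ha hb => rw [star_mul, map_mul, map_mul, ha, hb, Matrix.transpose_mul]
  | add a b ha hb => rw [star_add, map_add, map_add, ha, hb, Matrix.transpose_add]

lemma volJ_mul_rep (x : CliffordAlgebra negSq) :
    volJ * rep x = rep (CliffordAlgebra.involute x) * volJ := by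
  induction x using CliffordAlgebra.induction with
  | algebraMap r => simp [Algebra.commutes]
  | ι v => rw [CliffordAlgebra.involute_ι, map_neg, rep_ι, volJ_mul_cl, neg_mul]
  | mul a b ha hb => rw [map_mul, map_mul, map_mul, ← mul_assoc, ha, mul_assoc, hb, mul_assoc]
  | add a b ha hb => rw [map_add, map_add, map_add, mul_add, add_mul, ha, hb]

lemma rep_spin_transpose_mul_self (s : Spin6) : (rep s.1)ᵀ * rep s.1 = 1 := by
  rw [← rep_star, ← map_mul, spinGroup.star_mul_self_of_mem s.2, map_one]

/-- Elements of `Spin(6)` are even, so they commute with `J`. -/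
lemma rep_spin_mul_volJ (s : Spin6) : rep s.1 * volJ = volJ * rep s.1 := by
  rw [volJ_mul_rep, spinGroup.involute_eq s.2]

lemma LiesOver.cl_mul {s : Spin6} {A : Matrix (Fin 6) (Fin 6) ℝ} (h : LiesOver s A) (v : Vec) :
    cl (A *ᵥ v) * rep s.1 = rep s.1 * cl v := by
  have h1 : ((s⁻¹ : Spin6) : CliffordAlgebra negSq) * s.1 = 1 :=
    congrArg Subtype.val (inv_mul_cancel s)
  rw [← rep_ι, ← rep_ι, ← h v, ← map_mul, mul_assoc, h1, mul_one, map_mul]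

section Manifold

variable {M : Type*} [TopologicalSpace M] [ChartedSpace E6 M] [IsManifold (𝓡 6) ∞ M]
variable {g : Metric M} {o : ManifoldOrientation M} {ι : Type*}

/-! ### Orthonormal frames -/

lemma IsOrientedOrthonormal.eq_sum {x : M} {f : Fin 6 → TangentSpace (𝓡 6) x}
    (hf : IsOrientedOrthonormal g o x f) (X : TangentSpace (𝓡 6) x) :
    X = ∑ a, g.inner x (f a) X • f a := by
  obtain ⟨h, b, rfl, -⟩ := hf
  have h1 : ∀ a, g.inner x (b a) X = b.repr X a := fun a => by
    conv_lhs => rw [← b.sum_repr X]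
    simp [-Module.Basis.sum_repr, map_sum, h]
  simp_rw [h1]
  exact (b.sum_repr X).symm

lemma IsOrientedOrthonormal.inner_sum {x : M} {f : Fin 6 → TangentSpace (𝓡 6) x}
    (hf : IsOrientedOrthonormal g o x f) (v : Vec) (a : Fin 6) :
    g.inner x (f a) (∑ b, v b • f b) = v a := by
  simp [map_sum, hf.1]

lemma IsOrientedOrthonormal.inner_sum_sum {x : M} {f : Fin 6 → TangentSpace (𝓡 6) x}
    (hf : IsOrientedOrthonormal g o x f) (v w : Vec) :
    g.inner x (∑ b, v b • f b) (∑ b, w b • f b) = v ⬝ᵥ w := by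
  simp [map_sum, hf.1, dotProduct, mul_comm]

/-- The rotation of a positively oriented orthonormal frame is one again. -/
lemma IsOrientedOrthonormal.rotate {x : M} {f : Fin 6 → TangentSpace (𝓡 6) x}
    (hf : IsOrientedOrthonormal g o x f) (A : SO6) :
    IsOrientedOrthonormal g o x (fun a => ∑ b, A.1 b a • f b) := by
  have hin : ∀ a c, g.inner x (∑ b, A.1 b a • f b) (∑ b, A.1 b c • f b) =
      if a = c then 1 else 0 := fun a c => by
    rw [hf.inner_sum_sum (fun b => A.1 b a) (fun b => A.1 b c)]
    have := congrFun (congrFun (SO6.transpose_mul_self A) a) c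
    rwa [Matrix.mul_apply, Matrix.one_apply] at this
  refine ⟨hin, ?_⟩
  obtain ⟨-, b, hb, ho⟩ := hf
  have hdet : b.det (fun a => ∑ c, A.1 c a • f c) = 1 := by
    rw [Module.Basis.det_apply]
    have : b.toMatrix (fun a => ∑ c, A.1 c a • f c) = A.1 := by
      ext p q
      simp [Module.Basis.toMatrix_apply, ← hb, map_sum, Finsupp.single_apply]
    rw [this]
    exact (Matrix.mem_specialOrthogonalGroup_iff.1 A.2).2
  have hu : IsUnit (b.det (fun a => ∑ c, A.1 c a • f c)) := by rw [hdet]; exact isUnit_one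
  obtain ⟨hli, hsp⟩ := (Module.Basis.is_basis_iff_det b).2 hu
  refine ⟨Module.Basis.mk hli hsp.ge, Module.Basis.coe_mk _ _, ?_⟩
  rw [← ho, eq_comm, Module.Basis.orientation_eq_iff_det_pos, Module.Basis.coe_mk, hdet]
  exact one_pos

/-- Two positively oriented orthonormal frames differ by a rotation. -/
lemma IsOrientedOrthonormal.exists_rotate {x : M} {f f' : Fin 6 → TangentSpace (𝓡 6) x}
    (hf : IsOrientedOrthonormal g o x f) (hf' : IsOrientedOrthonormal g o x f') :
    ∃ A : SO6, ∀ a, f' a = ∑ b, A.1 b a • f b := by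
  let A : Matrix (Fin 6) (Fin 6) ℝ := fun b a => g.inner x (f b) (f' a)
  have hA : ∀ a, f' a = ∑ b, A b a • f b := fun a => hf.eq_sum (f' a)
  have h1 : Aᵀ * A = 1 := by
    ext a c
    have := hf'.1 a c
    rw [hA a, hA c, hf.inner_sum_sum (fun b => A b a) (fun b => A b c)] at this
    rwa [Matrix.mul_apply, Matrix.one_apply]
  have hd : A.det = 1 := by
    have h2 : A.det * A.det = 1 := by
      have := congrArg Matrix.det h1
      rwa [Matrix.det_mul, Matrix.det_transpose, Matrix.det_one] at this
    obtain ⟨-, b, hb, ho⟩ := hf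
    obtain ⟨-, b', hb', ho'⟩ := hf'
    have hpos : 0 < b.det b' := by
      rw [← Module.Basis.orientation_eq_iff_det_pos, ho, ho']
    have : b.toMatrix b' = A := by
      ext p q
      rw [Module.Basis.toMatrix_apply, hb', hA]
      simp [← hb, map_sum, Finsupp.single_apply]
    rw [Module.Basis.det_apply, this] at hpos
    nlinarith
  refine ⟨⟨A, ?_⟩, hA⟩
  rw [Matrix.mem_specialOrthogonalGroup_iff, Matrix.mem_orthogonalGroup_iff']
  exact ⟨h1, hd⟩

lemma sum_rotate {V : Type*} [AddCommGroup V] [Module ℝ V] (A : Matrix (Fin 6) (Fin 6) ℝ)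
    (f : Fin 6 → V) (v : Vec) :
    ∑ a, v a • ∑ b, A b a • f b = ∑ b, (A *ᵥ v) b • f b := by
  simp only [Finset.smul_sum, smul_smul, Matrix.mulVec, dotProduct, Finset.sum_smul]
  rw [Finset.sum_comm]
  exact Finset.sum_congr rfl fun b _ => Finset.sum_congr rfl fun a _ => by rw [mul_comm]

namespace SpinStructure

variable (σ : SpinStructure g o ι)

/-- The components of a tangent vector in the frame `i`. -/
noncomputable def comp (i : ι) (x : M) (X : TangentSpace (𝓡 6) x) : Vec :=
  fun a => g.inner x (σ.frame i a x) X

/-- The tangent vector with given components in the frame `i`. -/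
noncomputable def vec (i : ι) (x : M) (v : Vec) : TangentSpace (𝓡 6) x :=
  ∑ a, v a • σ.frame i a x

variable {σ} {i j : ι} {x : M}

lemma clAt_eq (X : TangentSpace (𝓡 6) x) : σ.clAt i x X = cl (σ.comp i x X) := rfl

lemma comp_vec (hx : x ∈ σ.baseSet i) (v : Vec) : σ.comp i x (σ.vec i x v) = v :=
  funext fun a => (σ.frame_orthonormal i x hx).inner_sum v a

lemma vec_comp (hx : x ∈ σ.baseSet i) (X : TangentSpace (𝓡 6) x) :
    σ.vec i x (σ.comp i x X) = X :=
  ((σ.frame_orthonormal i x hx).eq_sum X).symm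

lemma comp_injective (hx : x ∈ σ.baseSet i) : Function.Injective (σ.comp i x) :=
  Function.LeftInverse.injective (vec_comp hx)

lemma comp_eq_mulVec (hi : x ∈ σ.baseSet i) (X : TangentSpace (𝓡 6) x) : σ.comp j x X =
    (Matrix.of fun a b => g.inner x (σ.frame j a x) (σ.frame i b x)) *ᵥ σ.comp i x X := by
  funext a
  conv_lhs => rw [← vec_comp hi X]
  simp [comp, vec, map_sum, Matrix.mulVec, dotProduct, mul_comm]

lemma clAt_mul_lift (hi : x ∈ σ.baseSet i) (hj : x ∈ σ.baseSet j) (X : TangentSpace (𝓡 6) x) :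
    σ.clAt j x X * rep (σ.lift i j x).1 = rep (σ.lift i j x).1 * σ.clAt i x X := by
  rw [clAt_eq, clAt_eq, comp_eq_mulVec hi, (σ.lift_liesOver i j x ⟨hi, hj⟩).cl_mul]

/-! ### Spinors in frames -/

variable (σ) in
/-- The representative over the frame `i` of an element of the fibre of the spinor bundle. -/
noncomputable def repr (i : ι) (x : M) (v : σ.spinorBundle.Fiber x) : Spinor :=
  σ.spinorBundle.coordChange (σ.indexAt x) i x v

variable (σ) in
/-- The element of the fibre of the spinor bundle with given representative over the frame `i`. -/
noncomputable def ofRepr (i : ι) (x : M) (v : Spinor) : σ.spinorBundle.Fiber x :=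
  σ.spinorBundle.coordChange i (σ.indexAt x) x v

lemma repr_ofRepr (hx : x ∈ σ.baseSet i) (v : Spinor) : σ.repr i x (σ.ofRepr i x v) = v := by
  rw [repr, ofRepr, σ.spinorBundle.coordChange_comp i (σ.indexAt x) i x
    ⟨⟨hx, σ.mem_baseSet_at x⟩, hx⟩]
  exact σ.spinorBundle.coordChange_self i x hx v

lemma lift_mulVec_repr (hi : x ∈ σ.baseSet i) (hj : x ∈ σ.baseSet j)
    (v : σ.spinorBundle.Fiber x) :
    rep (σ.lift i j x).1 *ᵥ σ.repr i x v = σ.repr j x v :=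
  σ.spinorBundle.coordChange_comp (σ.indexAt x) i j x ⟨⟨σ.mem_baseSet_at x, hi⟩, hj⟩ v

lemma repr_injective (hi : x ∈ σ.baseSet i) : Function.Injective (σ.repr i x) := by
  refine Function.LeftInverse.injective (g := σ.ofRepr i x) fun v => ?_
  exact (σ.spinorBundle.coordChange_comp (σ.indexAt x) i (σ.indexAt x) x
    ⟨⟨σ.mem_baseSet_at x, hi⟩, σ.mem_baseSet_at x⟩ v).trans
    (σ.spinorBundle.coordChange_self _ x (σ.mem_baseSet_at x) v)

lemma repr_neg (v : σ.spinorBundle.Fiber x) : σ.repr i x (-v) = -σ.repr i x v := map_neg _ _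

lemma repr_dotProduct_repr (hi : x ∈ σ.baseSet i) (hj : x ∈ σ.baseSet j)
    (v w : σ.spinorBundle.Fiber x) :
    σ.repr j x v ⬝ᵥ σ.repr j x w = σ.repr i x v ⬝ᵥ σ.repr i x w := by
  rw [← lift_mulVec_repr hi hj, ← lift_mulVec_repr hi hj, mulVec_dotProduct_eq,
    Matrix.mulVec_mulVec, rep_spin_transpose_mul_self, Matrix.one_mulVec]

/-- Whether a spinor induces a given pair does not depend on the frame. -/
lemma isInducedPair_repr (hi : x ∈ σ.baseSet i) (hj : x ∈ σ.baseSet j)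
    {v : σ.spinorBundle.Fiber x} {J : TangentSpace (𝓡 6) x → TangentSpace (𝓡 6) x}
    {Om : TangentSpace (𝓡 6) x → TangentSpace (𝓡 6) x → TangentSpace (𝓡 6) x → ℝ}
    (h : IsInducedPair (σ.clAt i x) (σ.repr i x v) J Om) :
    IsInducedPair (σ.clAt j x) (σ.repr j x v) J Om := by
  rw [← lift_mulVec_repr hi hj]
  exact h.conj (rep_spin_transpose_mul_self _) (rep_spin_mul_volJ _) (clAt_mul_lift hi hj)

/-- A section of the spinor bundle is smooth if its representatives over one frame are. -/
lemma contMDiffOn_section_iff {s : ∀ x, σ.spinorBundle.Fiber x} {U : Set M} (hU : IsOpen U)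
    (hi : U ⊆ σ.baseSet i) :
    ContMDiffOn (𝓡 6) ((𝓡 6).prod 𝓘(ℝ, Spinor)) ∞
      (fun x => (⟨x, s x⟩ : Bundle.TotalSpace Spinor σ.spinorBundle.Fiber)) U ↔
    ContMDiffOn (𝓡 6) 𝓘(ℝ, Spinor) ∞ (fun x => σ.repr i x (s x)) U :=
  haveI : MemTrivializationAtlas (σ.spinorBundle.localTriv i) := ⟨i, rfl⟩
  (σ.spinorBundle.localTriv i).contMDiffOn_section_iff hU hi

lemma contMDiffOn_coord (φ : σ.SpinorField) (i : ι) :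
    ContMDiffOn (𝓡 6) 𝓘(ℝ, Spinor) ∞ (coord φ i) (σ.baseSet i) :=
  (contMDiffOn_section_iff (σ.isOpen_baseSet i) subset_rfl).1 φ.contMDiff.contMDiffOn

open scoped Bundle in
lemma contMDiffOn_inner {X Y : ∀ x : M, TangentSpace (𝓡 6) x} {U : Set M}
    (hX : SmoothFieldOn X U) (hY : SmoothFieldOn Y U) :
    ContMDiffOn (𝓡 6) 𝓘(ℝ, ℝ) ∞ (fun x => g.inner x (X x) (Y x)) U := by
  let : Bundle.RiemannianBundle (fun x : M => TangentSpace (𝓡 6) x) := ⟨g.toRiemannianMetric⟩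
  exact ContMDiffOn.inner_bundle hX hY

end SpinStructure

end Manifold

/-! ### The pair induced by a spinor field -/

/-- `stdJ` as a linear map. -/
noncomputable def stdJLin : Vec →ₗ[ℝ] Vec where
  toFun := stdJ
  map_add' x y := by
    ext a
    fin_cases a <;> simp [stdJ] <;> ring
  map_smul' r x := by
    ext a
    fin_cases a <;> simp [stdJ]

/-- `toC3` as a real linear map. -/
noncomputable def toC3Lin : Vec →ₗ[ℝ] (Fin 3 → ℂ) where
  toFun := toC3
  map_add' := toC3_add
  map_smul' r x := by
    have := toC3_smul_sub_smul_stdJ r 0 x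
    simpa [← Complex.coe_smul] using this

/-- `stdOmega` as an alternating map. -/
noncomputable def stdOmegaAlt : Vec [⋀^Fin 3]→ₗ[ℝ] ℝ :=
  { Complex.reLm.compMultilinearMap
      (((Matrix.detRowAlternating (n := Fin 3) (R := ℂ)).toMultilinearMap.restrictScalars
        ℝ).compLinearMap fun _ => toC3Lin) with
    map_eq_zero_of_eq' := fun m l l' h hl => by
      change ((Matrix.detRowAlternating (n := Fin 3) (R := ℂ)) fun l => toC3 (m l)).re = 0
      rw [AlternatingMap.map_eq_zero_of_eq (Matrix.detRowAlternating (n := Fin 3) (R := ℂ))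
        (fun l => toC3 (m l)) (congrArg toC3 h) hl, Complex.zero_re] }

section Manifold

variable {M : Type*} [TopologicalSpace M] [ChartedSpace E6 M]

lemma contMDiffOn_sum_real {κ : Type*} [Fintype κ] {F : κ → M → ℝ} {U : Set M}
    (h : ∀ k, ContMDiffOn (𝓡 6) 𝓘(ℝ, ℝ) ∞ (F k) U) :
    ContMDiffOn (𝓡 6) 𝓘(ℝ, ℝ) ∞ (fun x => ∑ k, F k x) U :=
  contMDiffOn_finsetSum fun k _ => h k

lemma contMDiffOn_quadratic {ψ : M → Spinor} {U : Set M}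
    (hψ : ContMDiffOn (𝓡 6) 𝓘(ℝ, Spinor) ∞ ψ U) (N : Matrix (Fin 8) (Fin 8) ℝ) :
    ContMDiffOn (𝓡 6) 𝓘(ℝ, ℝ) ∞ (fun x => (N *ᵥ ψ x) ⬝ᵥ ψ x) U := by
  have h : ContDiff ℝ ∞ fun ψ : Spinor => (N *ᵥ ψ) ⬝ᵥ ψ := by
    simp only [Matrix.mulVec, dotProduct]
    fun_prop
  exact h.contMDiff.comp_contMDiffOn hψ

variable [IsManifold (𝓡 6) ∞ M] {g : Metric M} {o : ManifoldOrientation M} {ι : Type*}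

namespace SpinStructure

variable {σ : SpinStructure g o ι} {i j : ι} {x : M}

variable (σ) in
/-- The linear map `comp` of components in the frame `i`. -/
noncomputable def compLin (i : ι) (x : M) : TangentSpace (𝓡 6) x →ₗ[ℝ] Vec where
  toFun := σ.comp i x
  map_add' X Y := by ext a; simp [comp]
  map_smul' r X := by ext a; simp [comp]

/-- In the tangent space at a point, a unit spinor induces the pair which is standard in the
rotated frame. -/
lemma exists_adapted_pair (hx : x ∈ σ.baseSet i) {ψ : Spinor} (hψ : ψ ⬝ᵥ ψ = 1) :
    ∃ (J : TangentSpace (𝓡 6) x →ₗ[ℝ] TangentSpace (𝓡 6) x)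
      (Om : (TangentSpace (𝓡 6) x) [⋀^Fin 3]→ₗ[ℝ] ℝ),
      IsInducedPair (σ.clAt i x) ψ J (fun X Y Z => Om ![X, Y, Z]) ∧
      ∃ f : Fin 6 → TangentSpace (𝓡 6) x, IsOrientedOrthonormal g o x f ∧
        (∀ v : Vec, J (∑ a, v a • f a) = ∑ a, stdJ v a • f a) ∧
        ∀ v : Fin 3 → Vec, Om (fun l => ∑ a, v l a • f a) = stdOmega v := by
  obtain ⟨A, hA⟩ := exists_SO6_isInducedPair hψ
  have hf := σ.frame_orthonormal i x hx
  have hcomp : ∀ v : Vec, σ.comp i x (∑ a, v a • ∑ b, A.1 b a • σ.frame i b x) = A.1 *ᵥ v :=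
    fun v => by
      rw [sum_rotate]
      exact comp_vec hx _
  let J : TangentSpace (𝓡 6) x →ₗ[ℝ] TangentSpace (𝓡 6) x :=
    Fintype.linearCombination ℝ (fun a => σ.frame i a x) ∘ₗ Matrix.toLin' A.1 ∘ₗ stdJLin ∘ₗ
      Matrix.toLin' (A⁻¹).1 ∘ₗ σ.compLin i x
  refine ⟨J, stdOmegaAlt.compLinearMap (Matrix.toLin' (A⁻¹).1 ∘ₗ σ.compLin i x), ⟨?_, ?_⟩,
    fun a => ∑ b, A.1 b a • σ.frame i b x, hf.rotate A, ?_, ?_⟩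
  · intro X
    rw [clAt_eq, clAt_eq, ← hA.1]
    change cl (σ.comp i x (σ.vec i x _)) *ᵥ ψ = _
    rw [comp_vec hx]
    rfl
  · intro X Y Z
    rw [clAt_eq, clAt_eq, clAt_eq, ← hA.2]
    change stdOmega _ = stdOmega _
    congr 1
    funext l
    fin_cases l <;> rfl
  · intro v
    change σ.vec i x (rotJ A (σ.comp i x _)) = _
    rw [hcomp, sum_rotate, rotJ, SO6.inv_mulVec_mulVec]
    rfl
  · intro v
    change stdOmega _ = stdOmega _
    congr 1
    funext l
    change (A⁻¹).1 *ᵥ σ.comp i x _ = _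
    rw [hcomp, SO6.inv_mulVec_mulVec]

lemma contMDiffOn_comp {X : ∀ x : M, TangentSpace (𝓡 6) x} {U : Set M}
    (hX : SmoothFieldOn X U) (i : ι) (a : Fin 6) :
    ContMDiffOn (𝓡 6) 𝓘(ℝ, ℝ) ∞ (fun x => σ.comp i x (X x) a) (U ∩ σ.baseSet i) :=
  contMDiffOn_inner ((σ.smooth_frame i a).mono Set.inter_subset_right)
    (hX.mono Set.inter_subset_left)

lemma smoothFieldOn_vec {v : M → Vec} {U : Set M} (hU : U ⊆ σ.baseSet i)
    (hv : ∀ a, ContMDiffOn (𝓡 6) 𝓘(ℝ, ℝ) ∞ (fun x => v x a) U) :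
    SmoothFieldOn (fun x => σ.vec i x (v x)) U := by
  refine ContMDiffOn.sum_section fun a _ => ?_
  exact ContMDiffOn.smul_section (hv a) ((σ.smooth_frame i a).mono hU)

lemma cl_mul_cl_mul_cl (X Y Z : Vec) :
    cl X * cl Y * cl Z = ∑ a, ∑ b, ∑ c, (X a * Y b * Z c) • (gamma a * gamma b * gamma c) := by
  rw [cl_eq_sum, cl_eq_sum, cl_eq_sum, Finset.sum_mul_sum, Finset.sum_mul]
  refine Finset.sum_congr rfl fun a _ => ?_
  rw [Finset.sum_mul_sum]
  simp only [smul_mul_smul_comm]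

/-- Smoothness of a vector field may be checked locally. -/
lemma smoothFieldOn_of_inter {X : ∀ x : M, TangentSpace (𝓡 6) x} {U : Set M} (hU : IsOpen U)
    (h : ∀ i, SmoothFieldOn X (U ∩ σ.baseSet i)) : SmoothFieldOn X U := fun x hx =>
  ((h (σ.indexAt x)).contMDiffAt ((hU.inter (σ.isOpen_baseSet _)).mem_nhds
    ⟨hx, σ.mem_baseSet_at x⟩)).contMDiffWithinAt

/-- Every unit spinor field induces an `SU(3)`-structure, which is smooth because its components are
quadratic in the components of the spinor. -/
theorem exists_induces (φ : σ.SpinorField) (hφ : IsUnit φ) : ∃ S : SU3Structure g o,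
    Induces φ S := by
  have hpt := fun x => exists_adapted_pair (σ.mem_baseSet_at x) (hφ _ x (σ.mem_baseSet_at x))
  choose J Om hind had using hpt
  have hI : ∀ i, ∀ x ∈ σ.baseSet i, IsInducedPair (σ.clAt i x) (coord φ i x) (J x)
      (fun X Y Z => Om x ![X, Y, Z]) := fun i x hx =>
    isInducedPair_repr (σ.mem_baseSet_at x) hx (hind x)
  -- `(e_a, J_φ X) = (e_a · φ, J (X · φ))`
  have hcompJ : ∀ i, ∀ x ∈ σ.baseSet i, ∀ X a, σ.comp i x (J x X) a =
      ∑ b, σ.comp i x X b * (((-(gamma a * volJ * gamma b)) *ᵥ coord φ i x) ⬝ᵥ coord φ i x) := by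
    intro i x hx X a
    have h1 := cl_mulVec_dotProduct_cl (σ.comp i x (J x X)) (Pi.single a 1) (coord φ i x)
    rw [← clAt_eq, (hI i x hx).1, hφ i x hx, mul_one, dotProduct_single, mul_one, cl_single] at h1
    rw [← h1, clAt_eq, cl_eq_sum]
    simp only [Matrix.sum_mulVec, Matrix.mulVec_sum, sum_dotProduct, Matrix.smul_mulVec,
      Matrix.mulVec_smul, smul_dotProduct, smul_eq_mul]
    refine Finset.sum_congr rfl fun b _ => ?_
    rw [Matrix.neg_mulVec, mul_assoc (gamma a), ← Matrix.mulVec_mulVec, ← cl_single a,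
      neg_dotProduct, cl_mulVec_dotProduct, neg_neg, ← Matrix.mulVec_mulVec]
  refine ⟨⟨J, Om, had, ?_, ?_⟩, hI⟩
  · intro U X hU hX
    refine smoothFieldOn_of_inter (σ := σ) hU fun i => ?_
    have h1 : SmoothFieldOn (fun x => σ.vec i x (σ.comp i x (J x (X x)))) (U ∩ σ.baseSet i) := by
      refine smoothFieldOn_vec Set.inter_subset_right fun a => ?_
      refine ContMDiffOn.congr ?_ fun x hx => hcompJ i x hx.2 (X x) a
      exact contMDiffOn_sum_real fun b => (contMDiffOn_comp hX i b).mul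
        (contMDiffOn_quadratic ((contMDiffOn_coord φ i).mono Set.inter_subset_right) _)
    exact h1.congr fun x hx => congrArg (Bundle.TotalSpace.mk x) (vec_comp hx.2 _).symm
  · intro U X hU hX x hx
    refine ContMDiffAt.contMDiffWithinAt ?_
    set i := σ.indexAt x
    refine ContMDiffOn.contMDiffAt (s := U ∩ σ.baseSet i) ?_
      ((hU.inter (σ.isOpen_baseSet _)).mem_nhds ⟨hx, σ.mem_baseSet_at x⟩)
    have hform : ∀ y ∈ U ∩ σ.baseSet i, Om y (fun l => X l y) = ∑ a, ∑ b, ∑ c,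
        (σ.comp i y (X 0 y) a * σ.comp i y (X 1 y) b * σ.comp i y (X 2 y) c) *
        (((-(gamma a * gamma b * gamma c)) *ᵥ coord φ i y) ⬝ᵥ coord φ i y) := by
      intro y hy
      have h1 : (fun l => X l y) = ![X 0 y, X 1 y, X 2 y] := by
        funext l
        fin_cases l <;> rfl
      rw [h1]
      refine ((hI i y hy.2).2 _ _ _).trans ?_
      rw [clAt_eq, clAt_eq, clAt_eq, cl_mul_cl_mul_cl]
      simp only [Matrix.sum_mulVec, sum_dotProduct, Matrix.smul_mulVec, smul_dotProduct,
        smul_eq_mul, Matrix.neg_mulVec, neg_dotProduct, mul_neg, Finset.sum_neg_distrib]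
    refine ContMDiffOn.congr ?_ hform
    refine contMDiffOn_sum_real fun a => contMDiffOn_sum_real fun b => contMDiffOn_sum_real fun c =>
      (((contMDiffOn_comp (hX 0) i a).mul (contMDiffOn_comp (hX 1) i b)).mul
        (contMDiffOn_comp (hX 2) i c)).mul
        (contMDiffOn_quadratic ((contMDiffOn_coord φ i).mono Set.inter_subset_right) _)

/-- A spinor field induces at most one `SU(3)`-structure. -/
lemma Induces.unique {φ : σ.SpinorField} (hφ : IsUnit φ) {S S' : SU3Structure g o}
    (h : Induces φ S) (h' : Induces φ S') : S = S' := by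
  have key : ∀ x, S.J x = S'.J x ∧ S.Om x = S'.Om x := fun x => by
    have hx := σ.mem_baseSet_at x
    obtain ⟨h1, h2⟩ := IsInducedPair.unique (comp_injective hx) (hφ _ x hx)
      (h _ x hx) (h' _ x hx)
    refine ⟨LinearMap.ext (congrFun h1), AlternatingMap.ext fun X => ?_⟩
    have h3 : X = ![X 0, X 1, X 2] := by
      funext l
      fin_cases l <;> rfl
    rw [h3]
    exact congrFun (congrFun (congrFun h2 (X 0)) (X 1)) (X 2)
  obtain ⟨J, Om, _, _, _⟩ := S
  obtain ⟨J', Om', _, _, _⟩ := S'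
  obtain rfl : J = J' := funext fun x => (key x).1
  obtain rfl : Om = Om' := funext fun x => (key x).2
  rfl

lemma Induces.neg {φ : σ.SpinorField} {S : SU3Structure g o} (h : Induces φ S) :
    Induces (-φ) S := fun i x hx => by
  have h1 : coord (-φ) i x = -coord φ i x := repr_neg _
  rw [h1]
  exact (h i x hx).neg

end SpinStructure
end Manifold

/-! ### Sign cocycles on simply connected spaces -/

/-- On a simply connected space every cocycle with values in `{1, -1}` is a coboundary: it defines
a double covering, and the identity lifts to a section of it. -/
lemma exists_sign_section {X κ : Type*} [TopologicalSpace X] [SimplyConnectedSpace X]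
    [LocallyPathConnectedSpace X] (U : κ → Set X) (hU : ∀ k, IsOpen (U k)) (idx : X → κ)
    (hidx : ∀ x, x ∈ U (idx x)) (ε : κ → κ → X → ℤˣ) (hself : ∀ k, ∀ x ∈ U k, ε k k x = 1)
    (hcomp : ∀ i j k, ∀ x ∈ U i ∩ U j ∩ U k, ε j k x * ε i j x = ε i k x)
    (hcont : ∀ i j, ContinuousOn (ε i j) (U i ∩ U j)) :
    ∃ η : κ → X → ℤˣ, (∀ k, ContinuousOn (η k) (U k)) ∧
      ∀ i j, ∀ x ∈ U i ∩ U j, η j x = ε i j x * η i x := by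
  let Z : FiberBundleCore κ X ℤˣ :=
    { baseSet := U
      isOpen_baseSet := hU
      indexAt := idx
      mem_baseSet_at := hidx
      coordChange := fun i j x u => ε i j x * u
      coordChange_self := fun i x hx u => by rw [hself i x hx, one_mul]
      continuousOn_coordChange := fun i j =>
        ((hcont i j).comp continuousOn_fst fun p hp => hp.1).mul continuousOn_snd
      coordChange_comp := fun i j k x hx u => by rw [← mul_assoc, hcomp i j k x hx] }
  have hcov : IsCoveringMap (Bundle.TotalSpace.proj (F := ℤˣ) (E := Z.Fiber)) :=
    FiberBundle.isCoveringMap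
  -- a continuous lift `F` of the identity, normalised to `1` at `x₀`
  obtain ⟨x₀⟩ : Nonempty X := inferInstance
  obtain ⟨F, ⟨-, hF⟩, -⟩ := hcov.existsUnique_continuousMap_lifts (ContinuousMap.id X) x₀
    (⟨x₀, (1 : ℤˣ)⟩ : Bundle.TotalSpace ℤˣ Z.Fiber) rfl
  have hproj : ∀ x, (F x).1 = x := fun x => congrFun hF x
  let f : X → ℤˣ := fun x => (F x).2
  have htriv : ∀ k x, (Z.localTriv k (F x)).2 = ε (idx x) k x * f x := fun k x => by
    change ε (idx (F x).1) k (F x).1 * f x = _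
    rw [hproj]
  refine ⟨fun k x => (Z.localTriv k (F x)).2, fun k => ?_, fun i j x hx => ?_⟩
  · refine continuous_snd.comp_continuousOn
      ((Z.localTriv k).continuousOn_toFun.comp F.continuous.continuousOn fun x hx => ?_)
    refine (Z.mem_localTriv_source k (F x)).2 ?_
    rw [hproj]
    exact hx
  · simp only [htriv]
    rw [← mul_assoc, hcomp _ _ _ x ⟨⟨hidx x, hx.1⟩, hx.2⟩]

lemma continuousOn_sign {X : Type*} [TopologicalSpace X] {d : X → ℝ} {W : Set X}
    (hd : ContinuousOn d W) (h0 : ∀ x ∈ W, d x ≠ 0) :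
    ContinuousOn (fun x => if 0 < d x then (1 : ℤˣ) else -1) W := by
  intro x hx
  rcases lt_or_gt_of_ne (h0 x hx) with h | h
  · have he : (fun x => if 0 < d x then (1 : ℤˣ) else -1) =ᶠ[nhdsWithin x W] fun _ => -1 := by
      filter_upwards [(hd x hx).eventually_lt_const h] with y hy
      rw [if_neg hy.not_gt]
    exact continuousWithinAt_const.congr_of_eventuallyEq he (if_neg h.not_gt)
  · have he : (fun x => if 0 < d x then (1 : ℤˣ) else -1) =ᶠ[nhdsWithin x W] fun _ => 1 := by
      filter_upwards [(hd x hx).eventually_const_lt h] with y hy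
      rw [if_pos hy]
    exact continuousWithinAt_const.congr_of_eventuallyEq he (if_pos h)

section Manifold

variable {M : Type*} [TopologicalSpace M] [ChartedSpace E6 M] [IsManifold (𝓡 6) ∞ M]
  {g : Metric M} {o : ManifoldOrientation M} {ι : Type*}

namespace SpinStructure

variable {σ : SpinStructure g o ι} {i j : ι} {x : M}

/-! ### The spinor field of an `SU(3)`-structure -/

/-- The components of the three-form of an `SU(3)`-structure in the frame `i`. -/
noncomputable def omComp (σ : SpinStructure g o ι) (S : SU3Structure g o) (i : ι) (x : M) :
    Vec → Vec → Vec → ℝ :=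
  fun X Y Z => S.Om x ![σ.vec i x X, σ.vec i x Y, σ.vec i x Z]

/-- At every point an `SU(3)`-structure is induced by a unit spinor. -/
lemma exists_unit_inducing (S : SU3Structure g o) (hx : x ∈ σ.baseSet i) :
    ∃ ψ : Spinor, ψ ⬝ᵥ ψ = 1 ∧
      IsInducedPair (σ.clAt i x) ψ (S.J x) (fun X Y Z => S.Om x ![X, Y, Z]) := by
  obtain ⟨f, hf, hJ, hO⟩ := S.adapted x
  obtain ⟨A, hA⟩ := (σ.frame_orthonormal i x hx).exists_rotate hf
  obtain ⟨ψ, hψ, hI⟩ := exists_isInducedPair A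
  have hvec : ∀ v : Vec, ∑ a, v a • f a = σ.vec i x (A.1 *ᵥ v) := fun v => by
    simp only [hA, sum_rotate]
    rfl
  have hX : ∀ X, X = ∑ a, ((A⁻¹).1 *ᵥ σ.comp i x X) a • f a := fun X => by
    rw [hvec, SO6.mulVec_inv_mulVec, vec_comp hx]
  refine ⟨ψ, hψ, fun X => ?_, fun X Y Z => ?_⟩
  · have h1 : σ.comp i x (S.J x X) = rotJ A (σ.comp i x X) := by
      conv_lhs => rw [hX X, hJ, hvec, comp_vec hx]
      rfl
    rw [clAt_eq, h1, hI.1]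
    rfl
  · have h1 : S.Om x ![X, Y, Z] = rotOmega A (σ.comp i x X) (σ.comp i x Y) (σ.comp i x Z) := by
      rw [rotOmega, ← hO]
      congr 1
      funext l
      fin_cases l
      exacts [hX X, hX Y, hX Z]
    exact h1.trans (hI.2 _ _ _)

/-- In a frame the projection to an inducing spinor is the polynomial `spinorProj` in the
components of the three-form. -/
lemma spinorProj_omComp {S : SU3Structure g o} (hx : x ∈ σ.baseSet i) {ψ : Spinor}
    (hψ : ψ ⬝ᵥ ψ = 1)
    (h : IsInducedPair (σ.clAt i x) ψ (S.J x) (fun X Y Z => S.Om x ![X, Y, Z])) :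
    spinorProj (omComp σ S i x) = Matrix.vecMulVec ψ ψ := by
  refine spinorProj_eq (J := fun v => σ.comp i x (S.J x (σ.vec i x v))) hψ ⟨fun v => ?_,
    fun X Y Z => ?_⟩
  · have := h.1 (σ.vec i x v)
    rwa [clAt_eq, clAt_eq, comp_vec hx] at this
  · have := h.2 (σ.vec i x X) (σ.vec i x Y) (σ.vec i x Z)
    rw [clAt_eq, clAt_eq, clAt_eq, comp_vec hx, comp_vec hx, comp_vec hx] at this
    exact this

lemma contMDiffOn_formMatrix_omComp (S : SU3Structure g o) (i : ι) (p q : Fin 8) :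
    ContMDiffOn (𝓡 6) 𝓘(ℝ, ℝ) ∞ (fun x => formMatrix (omComp σ S i x) p q) (σ.baseSet i) := by
  have h : ∀ a b c : Fin 6, ContMDiffOn (𝓡 6) 𝓘(ℝ, ℝ) ∞ (fun x => omComp σ S i x
      (Pi.single a 1) (Pi.single b 1) (Pi.single c 1)) (σ.baseSet i) := fun a b c => by
    refine (S.smooth_Om _ ![σ.frame i a, σ.frame i b, σ.frame i c] (σ.isOpen_baseSet i)
      fun l => ?_).congr fun x _ => ?_
    · fin_cases l
      exacts [σ.smooth_frame i a, σ.smooth_frame i b, σ.smooth_frame i c]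
    · rw [omComp]
      congr 1
      funext l
      fin_cases l <;> simp [vec, Pi.single_apply]
  simp only [formMatrix, Matrix.smul_apply, Matrix.sum_apply, smul_eq_mul]
  exact contMDiffOn_const.mul (contMDiffOn_sum_real fun a => contMDiffOn_sum_real fun b =>
    contMDiffOn_sum_real fun c => (h a b c).mul contMDiffOn_const)

lemma contMDiffOn_spinorProj_omComp (S : SU3Structure g o) (i : ι) (p q : Fin 8) :
    ContMDiffOn (𝓡 6) 𝓘(ℝ, ℝ) ∞ (fun x => spinorProj (omComp σ S i x) p q) (σ.baseSet i) := by
  simp only [spinorProj, Matrix.smul_apply, Matrix.add_apply, Matrix.mul_apply, smul_eq_mul]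
  exact contMDiffOn_const.mul ((contMDiffOn_formMatrix_omComp S i p q).add
    (contMDiffOn_sum_real fun r => (contMDiffOn_formMatrix_omComp S i p r).mul
      (contMDiffOn_formMatrix_omComp S i r q)))

/-- The `SU(3)`-structure `S` is induced at `x` by the element `v` of the fibre of the spinor
bundle, which has length one. -/
def InducesAt (S : SU3Structure g o) (x : M) (v : σ.spinorBundle.Fiber x) : Prop :=
  ∀ i, x ∈ σ.baseSet i → σ.repr i x v ⬝ᵥ σ.repr i x v = 1 ∧
    IsInducedPair (σ.clAt i x) (σ.repr i x v) (S.J x) (fun X Y Z => S.Om x ![X, Y, Z])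

lemma InducesAt.neg {S : SU3Structure g o} {v : σ.spinorBundle.Fiber x} (h : InducesAt S x v) :
    InducesAt S x (-v) := fun i hx => by
  rw [repr_neg, neg_dotProduct_neg]
  exact ⟨(h i hx).1, (h i hx).2.neg⟩

lemma InducesAt.eq_or_eq_neg {S : SU3Structure g o} {v w : σ.spinorBundle.Fiber x}
    (hv : InducesAt S x v) (hw : InducesAt S x w) : w = v ∨ w = -v := by
  have hx := σ.mem_baseSet_at x
  obtain ⟨h1, h2⟩ := hv _ hx
  obtain ⟨h3, h4⟩ := hw _ hx
  have h5 := vecMulVec_self_injective h1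
    ((spinorProj_omComp hx h1 h2).symm.trans (spinorProj_omComp hx h3 h4))
  rw [← repr_neg] at h5
  exact h5.imp (fun h => repr_injective hx h) (fun h => repr_injective hx h)

/-- Near every point there is a smooth unit spinor field inducing a given `SU(3)`-structure. -/
lemma exists_local_inducing (σ : SpinStructure g o ι) (S : SU3Structure g o) (x₀ : M) :
    ∃ (U : Set M) (s : ∀ x, σ.spinorBundle.Fiber x), IsOpen U ∧ x₀ ∈ U ∧
      U ⊆ σ.baseSet (σ.indexAt x₀) ∧
      ContMDiffOn (𝓡 6) ((𝓡 6).prod 𝓘(ℝ, Spinor)) ∞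
        (fun x => (⟨x, s x⟩ : Bundle.TotalSpace Spinor σ.spinorBundle.Fiber)) U ∧
      ∀ x ∈ U, InducesAt S x (s x) := by
  set i := σ.indexAt x₀
  have hx₀ : x₀ ∈ σ.baseSet i := σ.mem_baseSet_at x₀
  obtain ⟨v, hv, hvI⟩ := exists_unit_inducing S hx₀
  -- project the constant spinor `v` to the line of inducing spinors, and normalise
  let P : M → Spinor := fun x => spinorProj (omComp σ S i x) *ᵥ v
  let u : M → ℝ := fun x => P x ⬝ᵥ v
  have hP : ∀ p, ContMDiffOn (𝓡 6) 𝓘(ℝ, ℝ) ∞ (fun x => P x p) (σ.baseSet i) := fun p =>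
    contMDiffOn_sum_real fun q => (contMDiffOn_spinorProj_omComp S i p q).mul contMDiffOn_const
  have hu : ContMDiffOn (𝓡 6) 𝓘(ℝ, ℝ) ∞ u (σ.baseSet i) :=
    contMDiffOn_sum_real fun p => (hP p).mul contMDiffOn_const
  have hPψ : ∀ x ∈ σ.baseSet i, ∀ ψ : Spinor, ψ ⬝ᵥ ψ = 1 →
      IsInducedPair (σ.clAt i x) ψ (S.J x) (fun X Y Z => S.Om x ![X, Y, Z]) →
      P x = (ψ ⬝ᵥ v) • ψ := fun x hx ψ hψ hI => by
    simp only [P]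
    rw [spinorProj_omComp hx hψ hI, Matrix.vecMulVec_mulVec]
    ext p
    simp [mul_comm]
  let U : Set M := σ.baseSet i ∩ u ⁻¹' Set.Ioi 0
  have hUo : IsOpen U := hu.continuousOn.isOpen_inter_preimage (σ.isOpen_baseSet i) isOpen_Ioi
  refine ⟨U, fun x => σ.ofRepr i x ((Real.sqrt (u x))⁻¹ • P x), hUo, ⟨hx₀, ?_⟩,
    Set.inter_subset_left, ?_, fun x hx => ?_⟩
  · change 0 < u x₀
    simp only [u]
    rw [hPψ x₀ hx₀ v hv hvI, smul_dotProduct, hv]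
    norm_num
  · rw [contMDiffOn_section_iff hUo Set.inter_subset_left]
    have h1 : ContMDiffOn (𝓡 6) 𝓘(ℝ, Spinor) ∞ (fun x => (Real.sqrt (u x))⁻¹ • P x) U := by
      rw [contMDiffOn_pi_space]
      intro p
      have h2 : ContMDiffOn (𝓡 6) 𝓘(ℝ, ℝ) ∞ (fun x => (Real.sqrt (u x))⁻¹) U := by
        have h3 : ContDiffOn ℝ ∞ (fun t : ℝ => (Real.sqrt t)⁻¹) (Set.Ioi 0) := fun t ht =>
          ((Real.contDiffAt_sqrt (ne_of_gt ht)).inv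
            (Real.sqrt_pos.2 ht).ne').contDiffWithinAt
        exact h3.contMDiffOn.comp (hu.mono Set.inter_subset_left) fun x hx => hx.2
      exact h2.mul ((hP p).mono Set.inter_subset_left)
    exact h1.congr fun x hx => repr_ofRepr hx.1 _
  · obtain ⟨ψ, hψ, hI⟩ := exists_unit_inducing S hx.1
    have hPx := hPψ x hx.1 ψ hψ hI
    have hux : u x = (ψ ⬝ᵥ v) * (ψ ⬝ᵥ v) := by
      simp only [u]
      rw [hPx, smul_dotProduct, smul_eq_mul]
    have hu0 : 0 < (ψ ⬝ᵥ v) * (ψ ⬝ᵥ v) := hux ▸ hx.2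
    have hne : ψ ⬝ᵥ v ≠ 0 := fun h => by simp [h] at hu0
    have hs : (Real.sqrt (u x))⁻¹ • P x = ψ ∨ (Real.sqrt (u x))⁻¹ • P x = -ψ := by
      rw [hux, Real.sqrt_mul_self_eq_abs, hPx, smul_smul]
      rcases abs_choice (ψ ⬝ᵥ v) with h | h <;> rw [h]
      · left; rw [inv_mul_cancel₀ hne, one_smul]
      · right; rw [inv_neg, neg_mul, inv_mul_cancel₀ hne, neg_one_smul]
    intro j hj
    have hi : σ.repr i x (σ.ofRepr i x ((Real.sqrt (u x))⁻¹ • P x)) ⬝ᵥ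
        σ.repr i x (σ.ofRepr i x ((Real.sqrt (u x))⁻¹ • P x)) = 1 ∧
        IsInducedPair (σ.clAt i x) (σ.repr i x (σ.ofRepr i x ((Real.sqrt (u x))⁻¹ • P x)))
          (S.J x) (fun X Y Z => S.Om x ![X, Y, Z]) := by
      rw [repr_ofRepr hx.1]
      rcases hs with h | h <;> rw [h]
      · exact ⟨hψ, hI⟩
      · rw [neg_dotProduct_neg]
        exact ⟨hψ, hI.neg⟩
    rw [repr_dotProduct_repr hx.1 hj]
    exact ⟨hi.1, isInducedPair_repr hx.1 hj hi.2⟩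

/-- On a simply connected manifold, every `SU(3)`-structure is induced by a unit spinor field. -/
theorem exists_spinorField_induces [SimplyConnectedSpace M] (σ : SpinStructure g o ι)
    (S : SU3Structure g o) : ∃ φ : σ.SpinorField, IsUnit φ ∧ Induces φ S := by
  have : LocallyPathConnectedSpace M := ChartedSpace.locallyPathConnectedSpace E6 M
  choose U s hUo hxU hUb hs hind using exists_local_inducing σ S
  -- on overlaps `s x` and `s y` differ by the sign of their inner product `d x y = ± 1`
  let d : M → M → M → ℝ := fun x y z =>
    σ.repr (σ.indexAt z) z (s x z) ⬝ᵥ σ.repr (σ.indexAt z) z (s y z)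
  have hd : ∀ x y, ContinuousOn (d x y) (U x ∩ U y) := fun x y => by
    have hsub : U x ∩ U y ⊆ σ.baseSet (σ.indexAt x) := Set.inter_subset_left.trans (hUb x)
    have hopen := (hUo x).inter (hUo y)
    have h1 := ((contMDiffOn_section_iff hopen hsub).1
      ((hs x).mono Set.inter_subset_left)).continuousOn
    have h2 := ((contMDiffOn_section_iff hopen hsub).1
      ((hs y).mono Set.inter_subset_right)).continuousOn
    have h3 : Continuous fun q : Spinor × Spinor => q.1 ⬝ᵥ q.2 :=
      Continuous.dotProduct continuous_fst continuous_snd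
    exact (h3.comp_continuousOn (h1.prodMk h2)).congr fun z hz =>
      repr_dotProduct_repr (hsub hz) (σ.mem_baseSet_at z) _ _
  have hunit : ∀ x, ∀ z ∈ U x, d x x z = 1 := fun x z hz =>
    (hind x z hz _ (σ.mem_baseSet_at z)).1
  have hsign : ∀ x y, ∀ z ∈ U x ∩ U y, (d x y z = 1 ∧ s y z = s x z) ∨
      (d x y z = -1 ∧ s y z = -s x z) := fun x y z hz => by
    rcases (hind x z hz.1).eq_or_eq_neg (hind y z hz.2) with h | h
    · exact .inl ⟨by rw [← hunit x z hz.1]; simp only [d, h], h⟩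
    · exact .inr ⟨by
        rw [← hunit x z hz.1]
        simp only [d, h, repr_neg, dotProduct_neg], h⟩
  let ε : M → M → M → ℤˣ := fun x y z => if 0 < d x y z then 1 else -1
  have hε : ∀ x y, ∀ z ∈ U x ∩ U y, s y z = ε x y z • s x z := fun x y z hz => by
    rcases hsign x y z hz with ⟨h1, h2⟩ | ⟨h1, h2⟩
    · simp [ε, h1, h2]
    · have : ¬ (0 : ℝ) < -1 := by norm_num
      simp [ε, h1, h2, this]
  have hs0 : ∀ x, ∀ z ∈ U x, s x z ≠ -s x z := fun x z hz h => by
    have h1 : d x x z = -d x x z := by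
      simp only [d]
      nth_rewrite 2 [h]
      rw [repr_neg, dotProduct_neg]
    rw [hunit x z hz] at h1
    norm_num at h1
  have hcancel : ∀ x, ∀ z ∈ U x, ∀ a b : ℤˣ, a • s x z = b • s x z → a = b := by
    intro x z hz a b h
    have h0 := hs0 x z hz
    rcases Int.units_eq_one_or a with rfl | rfl <;> rcases Int.units_eq_one_or b with rfl | rfl
    · rfl
    · simp only [one_smul, Units.neg_smul] at h
      exact absurd h h0
    · simp only [one_smul, Units.neg_smul] at h
      exact absurd h.symm h0
    · rfl
  obtain ⟨η, hηc, hη⟩ := exists_sign_section U hUo id hxU ε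
    (fun x z hz => by simp only [ε, hunit x z hz, zero_lt_one, if_true])
    (fun x y w z hz => by
      refine hcancel x z hz.1.1 _ _ ?_
      rw [mul_smul, ← hε x y z hz.1, ← hε y w z ⟨hz.1.2, hz.2⟩, ← hε x w z ⟨hz.1.1, hz.2⟩])
    (fun x y => continuousOn_sign (hd x y) fun z hz => by
      rcases hsign x y z hz with ⟨h, -⟩ | ⟨h, -⟩ <;> rw [h] <;> norm_num)
  -- the local spinor fields `η • s` agree on overlaps
  let φ : ∀ z, σ.spinorBundle.Fiber z := fun z => η z z • s z z
  have hφ : ∀ x, ∀ z ∈ U x, φ z = η x z • s x z := fun x z hz => by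
    have h1 : ε x z z * ε x z z = 1 := Int.units_mul_self _
    simp only [φ]
    rw [hη x z z ⟨hz, hxU z⟩, hε x z z ⟨hz, hxU z⟩, smul_smul, mul_right_comm, h1, one_mul]
  have hφI : ∀ z, InducesAt S z (φ z) := fun z => by
    simp only [φ]
    rcases Int.units_eq_one_or (η z z) with h | h <;> rw [h]
    · rw [one_smul]
      exact hind z z (hxU z)
    · rw [Units.neg_smul, one_smul]
      exact (hind z z (hxU z)).neg
  have hsmooth : ContMDiff (𝓡 6) ((𝓡 6).prod 𝓘(ℝ, Spinor)) ∞
      (fun x => (⟨x, φ x⟩ : Bundle.TotalSpace Spinor σ.spinorBundle.Fiber)) := fun x => by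
    have hnhds := (hUo x).mem_nhds (hxU x)
    have hsx := (hs x).contMDiffAt hnhds
    have hη1 : ∀ᶠ z in nhds x, η x z = η x x :=
      ((hηc x).continuousAt hnhds).eventually_mem ((isOpen_discrete {η x x}).mem_nhds rfl)
    rcases Int.units_eq_one_or (η x x) with h | h
    · refine hsx.congr_of_eventuallyEq ?_
      filter_upwards [hη1, hnhds] with z hz1 hz2
      rw [hφ x z hz2, hz1, h, one_smul]
    · refine hsx.neg_section.congr_of_eventuallyEq ?_
      filter_upwards [hη1, hnhds] with z hz1 hz2
      rw [hφ x z hz2, hz1, h, Units.neg_smul, one_smul]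
      rfl
  exact ⟨⟨φ, hsmooth⟩, fun i x hx => (hφI x i hx).1, fun i x hx => (hφI x i hx).2⟩

/-- Two unit spinor fields on a connected manifold inducing the same `SU(3)`-structure agree up
to a global sign. -/
theorem eq_or_eq_neg_of_induces [PreconnectedSpace M] {φ ψ : σ.SpinorField} (hφ : IsUnit φ)
    (hψ : IsUnit ψ) {S : SU3Structure g o} (h : Induces φ S) (h' : Induces ψ S) :
    φ = ψ ∨ φ = -ψ := by
  have hpt : ∀ x, φ x = ψ x ∨ φ x = -ψ x := fun x =>
    InducesAt.eq_or_eq_neg (S := S) (fun i hx => ⟨hψ i x hx, h' i x hx⟩)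
      (fun i hx => ⟨hφ i x hx, h i x hx⟩)
  -- the inner product of the two fields is continuous with values `± 1`
  let d : M → ℝ := fun x => σ.repr (σ.indexAt x) x (φ x) ⬝ᵥ σ.repr (σ.indexAt x) x (ψ x)
  have hd : Continuous d := by
    refine continuous_iff_continuousAt.2 fun x => ?_
    set i := σ.indexAt x
    have h3 : Continuous fun q : Spinor × Spinor => q.1 ⬝ᵥ q.2 :=
      Continuous.dotProduct continuous_fst continuous_snd
    have h4 : ContinuousOn d (σ.baseSet i) :=
      (h3.comp_continuousOn ((contMDiffOn_coord φ i).continuousOn.prodMk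
        (contMDiffOn_coord ψ i).continuousOn)).congr fun z hz =>
        repr_dotProduct_repr hz (σ.mem_baseSet_at z) _ _
    exact h4.continuousAt ((σ.isOpen_baseSet i).mem_nhds (σ.mem_baseSet_at x))
  have hψ1 : ∀ x, σ.repr (σ.indexAt x) x (ψ x) ⬝ᵥ σ.repr (σ.indexAt x) x (ψ x) = 1 :=
    fun x => hψ _ x (σ.mem_baseSet_at x)
  have hd1 : ∀ x, (d x = 1 ∧ φ x = ψ x) ∨ (d x = -1 ∧ φ x = -ψ x) := fun x => by
    rcases hpt x with hx | hx
    · exact .inl ⟨by simp only [d, hx, hψ1], hx⟩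
    · exact .inr ⟨by simp only [d, hx, repr_neg, neg_dotProduct, hψ1], hx⟩
  have hsgn : Continuous fun x => if 0 < d x then (1 : ℤˣ) else -1 := by
    rw [← continuousOn_univ]
    exact continuousOn_sign hd.continuousOn fun x _ => by
      rcases hd1 x with ⟨hx, -⟩ | ⟨hx, -⟩ <;> rw [hx] <;> norm_num
  have hneg : ¬ (0 : ℝ) < -1 := by norm_num
  by_cases hall : ∀ x, d x = 1
  · left
    refine ContMDiffSection.ext fun x => ?_
    rcases hd1 x with ⟨-, hx⟩ | ⟨hx, -⟩
    · exact hx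
    · have := hall x
      norm_num [hx] at this
  · right
    push Not at hall
    obtain ⟨y, hy⟩ := hall
    have hy' : d y = -1 := by
      rcases hd1 y with ⟨h1, -⟩ | ⟨h1, -⟩
      exacts [absurd h1 hy, h1]
    refine ContMDiffSection.ext fun x => ?_
    rcases hd1 x with ⟨hx, -⟩ | ⟨-, hx⟩
    · have h5 := PreconnectedSpace.constant ‹_› hsgn (x := x) (y := y)
      rw [hx, hy', if_pos one_pos, if_neg hneg] at h5
      exact absurd h5 (by decide)
    · exact hx

end SpinStructure
end Manifold

end SpinorSU3

theorem mainTheorem5 {M : Type*} [TopologicalSpace M] [T2Space M] [SecondCountableTopology M]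
    [ChartedSpace SpinorSU3.E6 M] [IsManifold (𝓡 6) ∞ M] [SimplyConnectedSpace M]
    (g : SpinorSU3.Metric M) (o : SpinorSU3.ManifoldOrientation M)
    {ι : Type*} (σ : SpinorSU3.SpinStructure g o ι) :
    (∃ Φ : (SpinorSU3.SO6 ⧸ SpinorSU3.SU3) ≃ₜ ℙ ℝ SpinorSU3.Spinor,
      ∀ (A : SpinorSU3.SO6) (φ : SpinorSU3.Spinor) (hφ : φ ⬝ᵥ φ = 1),
        Φ (A : SpinorSU3.SO6 ⧸ SpinorSU3.SU3) =
            Projectivization.mk ℝ φ (SpinorSU3.Spinor.ne_zero hφ) ↔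
          SpinorSU3.IsInducedPair SpinorSU3.cl φ (SpinorSU3.rotJ A) (SpinorSU3.rotOmega A)) ∧
    ∃ F : {φ : σ.SpinorField // SpinorSU3.SpinStructure.IsUnit φ} → SpinorSU3.SU3Structure g o,
      (∀ φ, SpinorSU3.SpinStructure.Induces φ.1 (F φ)) ∧
      Function.Surjective F ∧
      ∀ φ ψ, F φ = F ψ ↔ (φ.1 = ψ.1 ∨ φ.1 = -ψ.1) := by
  open SpinorSU3 SpinStructure in
  refine ⟨exists_homeomorph, ?_⟩
  choose F hF using fun φ : {φ : σ.SpinorField // IsUnit φ} => exists_induces φ.1 φ.2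
  refine ⟨F, hF, fun S => ?_, fun φ ψ => ⟨fun h => ?_, ?_⟩⟩
  · obtain ⟨φ, hφ, h⟩ := exists_spinorField_induces (σ := σ) S
    exact ⟨⟨φ, hφ⟩, (hF ⟨φ, hφ⟩).unique hφ h⟩
  · exact eq_or_eq_neg_of_induces φ.2 ψ.2 (hF φ) (h ▸ hF ψ)
  · rintro (h | h)
    · rw [Subtype.ext h]
    · exact (hF φ).unique φ.2 (h ▸ (hF ψ).neg)
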